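/- Let $K$ be a number field, $E/K$ an elliptic curve, $L$ a quadratic extension of $K$ and $p$ an odd prime. Write $C_n$ for the cyclic group of order $n$. For a field $F\in\{K,L\}$ let $E(F)[n]$ be the subgroup of points of $E(F)$ killed by $n$, and let $E(F)[p^\infty]=\bigcup_{k\ge 0}E(F)[p^k]$; regard $E(K)$ as a subgroup of $E(L)$. For a nonzero $d\in K$, let $E^d$ be the quadratic twist of $E$ by $d$: if $E$ is given by $y^2+a_1xy+a_3y=x^3+a_2x^2+a_4x+a_6$ and $b_2=a_1^2+4a_2$, $b_4=2a_4+a_1a_3$, $b_6=a_3^2+4a_6$, then $E^d$ is the elliptic curve $$y^2=x^3+\tfrac{d\,b_2}{4}x^2+\tfrac{d^2b_4}{2}x+\tfrac{d^3b_6}{4}$$ (so for $E: y^2=x^3+Ax+B$ it is $y^2=x^3+d^2Ax+d^3B$). Then: 1. If $E(K)[2]\cong C_1$, then $E(L)[2]\cong C_1$. 2. If $d\in K$, $d\neq 0$, then $E^d(K)[2]\cong E(K)[2]$. 3. If $E(K)[p]\cong C_1$ and $E(L)[p]\cong C_p\oplus C_p$, then $K$ contains a primitive $p$th root of unity. 4.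 If $E(K)[p]\cong C_p$ and $E(L)[p^\infty]\neq E(K)[p^\infty]$, then $E(L)[p]\cong C_p\oplus C_p$. 5. If $E(K)[p]\cong C_p$ and $E(L)[p]\cong C_p\oplus C_p$, then $K$ does not contain a primitive $p$th root of unity. 6. If $E(K)[p]\cong C_p\oplus C_p$, then $E(L)[p^\infty]=E(K)[p^\infty]$. -/

import Mathlib

open scoped WeierstrassCurve

namespace WeierstrassCurve

/-- The quadratic twist of the Weierstrass curve `E` by `d`, over a field of characteristic
different from `2`. Completing the square puts `E` in the form
`y ^ 2 = x ^ 3 + (b₂ / 4) x ^ 2 + (b₄ / 2) x + b₆ / 4`; its twist by `d` is the curve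
`d y ^ 2 = x ^ 3 + (b₂ / 4) x ^ 2 + (b₄ / 2) x + b₆ / 4`, which in Weierstrass form (scale by
`(x, y) ↦ (d x, d ^ 2 y)`) is
`y ^ 2 = x ^ 3 + (d b₂ / 4) x ^ 2 + (d ^ 2 b₄ / 2) x + d ^ 3 b₆ / 4`.
For `E : y ^ 2 = x ^ 3 + A x + B` it is `y ^ 2 = x ^ 3 + d ^ 2 A x + d ^ 3 B`. -/
def quadraticTwist {K : Type*} [Field K] (E : WeierstrassCurve K) (d : K) :
    WeierstrassCurve K where
  a₁ := 0
  a₂ := d * E.b₂ / 4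
  a₃ := 0
  a₄ := d ^ 2 * E.b₄ / 2
  a₆ := d ^ 3 * E.b₆ / 4

theorem quadraticTwist_Δ {K : Type*} [Field K] [CharZero K] (E : WeierstrassCurve K) (d : K) :
    (E.quadraticTwist d).Δ = d ^ 6 * E.Δ := by
  simp only [quadraticTwist, Δ, b₂, b₄, b₆, b₈]
  field_simp
  ring

/-- The quadratic twist of an elliptic curve by a nonzero `d` is an elliptic curve. -/
theorem quadraticTwist_isElliptic {K : Type*} [Field K] [CharZero K] (E : WeierstrassCurve K)
    [E.IsElliptic] {d : K} (hd : d ≠ 0) : (E.quadraticTwist d).IsElliptic := by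
  refine ⟨?_⟩
  rw [quadraticTwist_Δ]
  exact ((isUnit_iff_ne_zero.mpr hd).pow 6).mul E.isUnit_Δ

/-- Over a field containing a square root of `d`, the twist by `d` becomes isomorphic to the
original curve. -/
theorem exists_variableChange_quadraticTwist {K L : Type*} [Field K] [CharZero K] [Field L]
    [Algebra K L] (E : WeierstrassCurve K) {d : K} (hd : d ≠ 0) {e : L}
    (he : e ^ 2 = algebraMap K L d) :
    ∃ C : VariableChange L, C • (E.quadraticTwist d)⁄L = E⁄L := by
  have : CharZero L := charZero_of_injective_algebraMap (algebraMap K L).injective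
  have he0 : e ≠ 0 := by
    rintro rfl
    exact hd ((map_eq_zero (algebraMap K L)).mp (by rw [← he]; simp))
  have h2 : algebraMap K L 2 = 2 := map_ofNat (algebraMap K L) 2
  have h4 : algebraMap K L 4 = 4 := map_ofNat (algebraMap K L) 4
  refine ⟨⟨Units.mk0 e he0, 0, e * algebraMap K L E.a₁ / 2, e ^ 3 * algebraMap K L E.a₃ / 2⟩, ?_⟩
  ext <;> simp [variableChange_def, quadraticTwist, baseChange, map, b₂, b₄, b₆, ← he, h2, h4] <;>
    field_simp <;> ring

end WeierstrassCurve

/-! Let σ be the nontrivial element of Gal(L/K). Its fixed points in E(L) are those of E(K), and P +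
σP is always fixed. So if E(K)[n] = 0, then σ = -1 on E(L)[n]; for n = 2 this says σP = -P = P,
whence statement 1. If x has p-power order, σ negates x - σx; hence the p-primary torsion does not
grow unless some nonzero Q in E(L)[p] has σQ = -Q (`primaryComponent_eq_map`). As p is odd, such a Q
is independent of every fixed point. Combined with |E[p]| ≤ p², this gives 4 and 6. Statement 2
holds because the 2-torsion abscissas are roots of a cubic that the twist rescales by d.

Statements 3 and 5 need a Galois-equivariant pairing E[p] × E[p] → μ_p that is nontrivial on
independent points. If σ negates both points the pairing value is fixed, so it lies in K; if σ fixes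
one and negates the other, the value is inverted, so μ_p is not in K. The bound |E[p]| ≤ p² also
comes from this pairing.

The pairing is built from theta functions. Let L(nO) be the regular functions with a pole of order
at most n at infinity. If nR = 0, the n-th power of the ideal of R is principal, which yields g with
divisor n(R) - n(O), and h ↦ g · h(· - R) is an injective operator on L(nO). It is unique up to a
scalar (`IsTheta.exists_eq_mul`), and the commutator of the operators of S and T is the pairing. If
this were trivial for independent S and T in E[p], the two operators would have a common eigenvector
h in L(pO). Up to two exceptions, the p² translates of a zero of h by the span of S and T would be
zeros too, whereas h has at most 2p zeros (`weilPairing_ne_one`). -/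

section

open Polynomial

namespace WeierstrassCurve.Affine

variable {k : Type*} [Field k] {W : Affine k}

/-! ### Values of regular functions, and negation on the coordinate ring. -/

namespace CoordinateRing

/-- Evaluation of a regular function at an affine point. -/
noncomputable def evalAt {x y : k} (h : W.Equation x y) : W.CoordinateRing →ₐ[k] k :=
  AdjoinRoot.liftAlgHom W.polynomial (aeval x) y <| by
    have : ((aeval x : k[X] →ₐ[k] k) : k[X] →+* k) = evalRingHom x := by
      ext <;> simp
    rw [this]
    rw [eval₂_evalRingHom]
    exact h

lemma evalAt_mk_Y {x y : k} (h : W.Equation x y) : evalAt h (mk W X) = y :=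
  AdjoinRoot.liftAlgHom_root ..

lemma evalAt_algebraMap {x y : k} (h : W.Equation x y) (p : k[X]) :
    evalAt h (algebraMap k[X] W.CoordinateRing p) = p.eval x := by
  have : algebraMap k[X] W.CoordinateRing p = mk W (C p) := rfl
  rw [this, evalAt, AdjoinRoot.liftAlgHom_mk, eval₂_C]
  exact coe_aeval_eq_eval x ▸ rfl

lemma evalAt_smul {x y : k} (h : W.Equation x y) (p : k[X]) (f : W.CoordinateRing) :
    evalAt h (p • f) = p.eval x * evalAt h f := by
  rw [Algebra.smul_def, map_mul, evalAt_algebraMap]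

variable (W) in
/-- The automorphism of the coordinate ring induced by negation. -/
noncomputable def conj : W.CoordinateRing →ₐ[k[X]] W.CoordinateRing :=
  AdjoinRoot.liftAlgHom W.polynomial (Algebra.ofId k[X] W.CoordinateRing)
    (mk W W.negPolynomial) <| by
    have h (p : k[X]) : ((Algebra.ofId k[X] W.CoordinateRing :
        k[X] →ₐ[k[X]] W.CoordinateRing) : k[X] →+* W.CoordinateRing) p = mk W (C p) := rfl
    change eval₂ _ _ (X ^ 2 + C (C W.a₁ * X + C W.a₃) * X -
      C (X ^ 3 + C W.a₂ * X ^ 2 + C W.a₄ * X + C W.a₆)) = 0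
    rw [eval₂_sub, eval₂_add, eval₂_mul, eval₂_pow, eval₂_X, eval₂_C, eval₂_C, h, h,
      ← map_pow, ← map_mul, ← map_add, ← map_sub]
    exact AdjoinRoot.mk_eq_zero.mpr ⟨1, by simp only [polynomial, negPolynomial]; ring⟩

lemma conj_mk_Y : conj W (mk W X) = mk W W.negPolynomial :=
  AdjoinRoot.liftAlgHom_root ..

lemma conj_smul_basis (p q : k[X]) : conj W (p • (1 : W.CoordinateRing) + q • mk W X) =
    (p - q * (C W.a₁ * X + C W.a₃)) • (1 : W.CoordinateRing) + (-q) • mk W X := by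
  rw [map_add, map_smul, map_smul, map_one, conj_mk_Y]
  simp only [smul, negPolynomial, map_sub, map_neg, map_mul]
  ring

/-- The ring has rank 2 over `k[X]` with `conj` as its involution, so the norm is the product of the
two conjugates. This turns zeros of `f` into roots of a polynomial in the abscissa. -/
lemma mul_conj (f : W.CoordinateRing) :
    f * conj W f = algebraMap k[X] W.CoordinateRing (Algebra.norm k[X] f) := by
  obtain ⟨p, q, rfl⟩ := exists_smul_basis_eq f
  have : ∀ r : k[X], algebraMap k[X] W.CoordinateRing r = mk W (C r) := fun r => rfl
  rw [this, map_add, map_smul, map_smul, map_one, conj_mk_Y]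
  refine Eq.trans ?_ (coe_norm_smul_basis p q).symm
  simp only [smul, negPolynomial, map_sub, map_neg, map_mul, map_add]
  ring

lemma norm_conj (f : W.CoordinateRing) :
    Algebra.norm k[X] (conj W f) = Algebra.norm k[X] f := by
  obtain ⟨p, q, rfl⟩ := exists_smul_basis_eq f
  rw [conj_smul_basis, norm_smul_basis, norm_smul_basis]
  ring

lemma conj_conj (f : W.CoordinateRing) : conj W (conj W f) = f := by
  obtain ⟨p, q, rfl⟩ := exists_smul_basis_eq f
  rw [conj_smul_basis, conj_smul_basis]
  congr 2 <;> ring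

lemma map_conj_XYIdeal (x y : k) :
    (XYIdeal W x (C y)).map (conj W) = XYIdeal W x (C (W.negY x y)) := by
  have hX : conj W (XClass W x) = XClass W x := (conj W).commutes (X - C x)
  have hY : conj W (YClass W (C y)) =
      -(YClass W (C (W.negY x y))) + -algebraMap k[X] W.CoordinateRing (C W.a₁) * XClass W x := by
    have : YClass W (C y) = mk W X - mk W (C (C y)) := map_sub ..
    rw [this, map_sub, conj_mk_Y]
    have h2 : conj W (mk W (C (C y))) = mk W (C (C y)) := (conj W).commutes (C y)
    have h3 : algebraMap k[X] W.CoordinateRing (C W.a₁) = mk W (C (C W.a₁)) := rfl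
    rw [h2, h3, YClass, XClass, negY, negPolynomial, ← map_neg, ← map_neg, ← map_mul,
      ← map_add, ← map_sub]
    congr 1
    simp only [C_sub, C_neg, C_mul, C_add]
    ring
  rw [XYIdeal, Ideal.map_span, Set.image_pair, hX, hY, Ideal.span_pair_add_mul_left, Ideal.span_pair_neg,
    XYIdeal]

end CoordinateRing
end WeierstrassCurve.Affine

end

/-! ### Order of the pole at infinity and the spaces L(nO). -/

section

open Polynomial

namespace WeierstrassCurve.Affine

variable {k : Type*} [Field k] {W : Affine k}

namespace CoordinateRing

/-- The order of the pole at infinity of a regular function on the affine curve. -/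
noncomputable def poleOrder (f : W.CoordinateRing) : ℕ :=
  (Algebra.norm k[X] f).natDegree

/-- `X` has a pole of order 2 and `Y` one of order 3, so the two terms have orders of opposite
parity and cannot cancel. -/
lemma poleOrder_smul_basis_le_iff (p q : k[X]) (n : ℕ) :
    poleOrder (p • (1 : W.CoordinateRing) + q • mk W X) ≤ n ↔
      2 * p.natDegree ≤ n ∧ (q = 0 ∨ 2 * q.natDegree + 3 ≤ n) := by
  rw [poleOrder, natDegree_le_iff_degree_le, degree_norm_smul_basis, max_le_iff]
  refine and_congr ?_ ?_
  · by_cases hp : p = 0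
    · simp [hp]
    · rw [degree_eq_natDegree hp, two_nsmul, two_mul]
      norm_cast
  · by_cases hq : q = 0
    · simp [hq]
    · rw [degree_eq_natDegree hq, two_nsmul, two_mul, or_iff_right hq]
      norm_cast

lemma poleOrder_mul_le (f g : W.CoordinateRing) :
    poleOrder (f * g) ≤ poleOrder f + poleOrder g := by
  rw [poleOrder, map_mul]
  exact natDegree_mul_le

lemma norm_ne_zero {f : W.CoordinateRing} (hf : f ≠ 0) : Algebra.norm k[X] f ≠ 0 :=
  have : Module.Finite k[X] W.CoordinateRing := .of_basis (CoordinateRing.basis W)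
  Algebra.norm_ne_zero_iff.mpr hf

lemma poleOrder_mul {f g : W.CoordinateRing} (hf : f ≠ 0) (hg : g ≠ 0) :
    poleOrder (f * g) = poleOrder f + poleOrder g := by
  rw [poleOrder, map_mul, natDegree_mul (norm_ne_zero hf) (norm_ne_zero hg)]
  rfl

lemma poleOrder_conj (f : W.CoordinateRing) : poleOrder (conj W f) = poleOrder f := by
  rw [poleOrder, norm_conj, poleOrder]

lemma smul_eq_algebraMap_C_mul (c : k) (f : W.CoordinateRing) :
    c • f = algebraMap k[X] W.CoordinateRing (C c) * f := by
  rw [← Algebra.smul_def, ← algebraMap_smul k[X] c f]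
  rfl

variable (W) in
/-- The space of regular functions whose pole at infinity has order at most `n`. -/
noncomputable def poleLE (n : ℕ) : Submodule k W.CoordinateRing where
  carrier := {f | poleOrder f ≤ n}
  zero_mem' := by
    have h := (poleOrder_smul_basis_le_iff (W := W) 0 0 n).mpr (by simp)
    rw [zero_smul, zero_smul, zero_add] at h
    exact h
  add_mem' {f g} hf hg := by
    obtain ⟨p, q, rfl⟩ := exists_smul_basis_eq f
    obtain ⟨r, s, rfl⟩ := exists_smul_basis_eq g
    rw [Set.mem_ofPred_eq, poleOrder_smul_basis_le_iff] at hf hg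
    rw [add_add_add_comm, ← add_smul, ← add_smul, Set.mem_ofPred_eq, poleOrder_smul_basis_le_iff]
    have h1 := natDegree_add_le p r
    have h2 := natDegree_add_le q s
    refine ⟨by grind, ?_⟩
    rcases hf.2 with rfl | hq
    · simpa using hg.2
    · rcases hg.2 with rfl | hs
      · simpa using Or.inr hq
      · exact Or.inr (by grind)
  smul_mem' c f hf := by
    refine (?_ : poleOrder (c • f) ≤ poleOrder f).trans hf
    rw [smul_eq_algebraMap_C_mul, poleOrder, map_mul, Algebra.norm_algebraMap, ← C_pow]
    exact natDegree_C_mul_le ..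

lemma mem_poleLE {n : ℕ} {f : W.CoordinateRing} : f ∈ poleLE W n ↔ poleOrder f ≤ n := Iff.rfl

lemma poleLE_mono {m n : ℕ} (h : m ≤ n) : poleLE W m ≤ poleLE W n :=
  fun _ hf => le_trans (mem_poleLE.mp hf) h

lemma mul_mem_poleLE {m n : ℕ} {f g : W.CoordinateRing} (hf : f ∈ poleLE W m)
    (hg : g ∈ poleLE W n) : f * g ∈ poleLE W (m + n) :=
  (poleOrder_mul_le f g).trans (add_le_add hf hg)

lemma smul_basis_mem_poleLE {p q : k[X]} {n : ℕ} (hp : 2 * p.natDegree ≤ n)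
    (hq : 2 * q.natDegree + 3 ≤ n) : p • (1 : W.CoordinateRing) + q • mk W X ∈ poleLE W n :=
  (poleOrder_smul_basis_le_iff p q n).mpr ⟨hp, Or.inr hq⟩

lemma algebraMap_mem_poleLE {p : k[X]} {n : ℕ} (hp : 2 * p.natDegree ≤ n) :
    algebraMap k[X] W.CoordinateRing p ∈ poleLE W n := by
  have := (poleOrder_smul_basis_le_iff (W := W) p 0 n).mpr ⟨hp, Or.inl rfl⟩
  rwa [zero_smul, add_zero, ← Algebra.algebraMap_eq_smul_one] at this

lemma poleOrder_algebraMap (p : k[X]) :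
    poleOrder (algebraMap k[X] W.CoordinateRing p) = 2 * p.natDegree := by
  have h : Module.finrank k[X] W.CoordinateRing = 2 := by
    rw [Module.finrank_eq_card_basis (CoordinateRing.basis W), Fintype.card_fin]
  rw [poleOrder, Algebra.norm_algebraMap, natDegree_pow, h]

lemma XClass_eq (x : k) : XClass W x = algebraMap k[X] W.CoordinateRing (X - C x) := rfl

lemma XClass_mem_poleLE (x : k) : XClass W x ∈ poleLE W 2 := by
  rw [XClass_eq]
  exact algebraMap_mem_poleLE (by rw [natDegree_X_sub_C])

lemma evalAt_XClass {x y : k} (h : W.Equation x y) (a : k) : evalAt h (XClass W a) = x - a := by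
  rw [XClass_eq, evalAt_algebraMap, eval_sub, eval_X, eval_C]

lemma YClass_C_eq (y : k) : YClass W (C y) = (C (-y)) • (1 : W.CoordinateRing) +
    (1 : k[X]) • mk W X := by
  simp only [YClass, smul, map_sub, map_neg, map_one]
  ring

lemma evalAt_YClass_C {x y : k} (h : W.Equation x y) (b : k) :
    evalAt h (YClass W (C b)) = y - b := by
  rw [YClass_C_eq, map_add, evalAt_smul, evalAt_smul, evalAt_mk_Y, map_one, eval_C, eval_one]
  ring

lemma YClass_C_mem_poleLE (b : k) : YClass W (C b) ∈ poleLE W 3 := by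
  rw [YClass_C_eq]
  exact smul_basis_mem_poleLE (by rw [natDegree_C]; lia) (by rw [natDegree_one])

/-! ### Translation of regular functions by a point. -/

variable (W) in
/-- The product of `(X - a) ^ 2` and of the `X`-coordinate of the translate by `(a, b)`. -/
noncomputable def translateX (a b : k) : W.CoordinateRing :=
  YClass W (C b) ^ 2 + algebraMap k[X] W.CoordinateRing (C W.a₁) * YClass W (C b) * XClass W a -
    algebraMap k[X] W.CoordinateRing (X + C (W.a₂ + a)) * XClass W a ^ 2

variable (W) in
/-- The product of `(X - a) ^ 3` and of the `Y`-coordinate of the translate by `(a, b)`. -/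
noncomputable def translateY (a b : k) : W.CoordinateRing :=
  -(YClass W (C b) * (translateX W a b - algebraMap k[X] W.CoordinateRing (C a) * XClass W a ^ 2)) -
    algebraMap k[X] W.CoordinateRing (C (b + W.a₃)) * XClass W a ^ 3 -
    algebraMap k[X] W.CoordinateRing (C W.a₁) * XClass W a * translateX W a b

/-- The Weierstrass equation cancels the `Y ^ 2` and `X ^ 3` terms. The abscissa of the translate
takes the value `a` at infinity, so removing `a * (X - a) ^ 2` lowers the pole order from 4 to 3;
`translateY` needs this gain to have order at most 6. -/
lemma translateX_eq (a b : k) : translateX W a b =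
    algebraMap k[X] W.CoordinateRing (C a) * XClass W a ^ 2 +
    ((C (W.a₄ - W.a₁ * b + 3 * a ^ 2 + 2 * W.a₂ * a) * X +
      C (W.a₆ + b ^ 2 + W.a₁ * b * a - W.a₂ * a ^ 2 - 2 * a ^ 3)) • (1 : W.CoordinateRing) +
      C (-W.a₃ - 2 * b - W.a₁ * a) • mk W X) := by
  have h (p : k[X]) : algebraMap k[X] W.CoordinateRing p = mk W (C p) := rfl
  rw [translateX]
  simp only [smul, h, XClass, YClass, ← map_mul, ← map_add, ← map_sub, ← map_pow, mul_one]
  refine AdjoinRoot.mk_eq_mk.mpr ⟨1, ?_⟩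
  simp only [polynomial, map_add, map_sub, map_mul, map_pow, map_neg, map_ofNat]
  ring

lemma translateX_sub_mem_poleLE (a b : k) :
    translateX W a b - algebraMap k[X] W.CoordinateRing (C a) * XClass W a ^ 2 ∈
      poleLE W 3 := by
  rw [translateX_eq, add_sub_cancel_left]
  refine smul_basis_mem_poleLE ?_ (by rw [natDegree_C])
  have := natDegree_linear_le (a := W.a₄ - W.a₁ * b + 3 * a ^ 2 + 2 * W.a₂ * a)
    (b := W.a₆ + b ^ 2 + W.a₁ * b * a - W.a₂ * a ^ 2 - 2 * a ^ 3)
  lia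

lemma C_mul_mem_poleLE (c : k) {n : ℕ} {f : W.CoordinateRing} (hf : f ∈ poleLE W n) :
    algebraMap k[X] W.CoordinateRing (C c) * f ∈ poleLE W n :=
  zero_add n ▸ mul_mem_poleLE (m := 0) (algebraMap_mem_poleLE (by rw [natDegree_C])) hf

lemma pow_mem_poleLE {n : ℕ} {f : W.CoordinateRing} (hf : f ∈ poleLE W n) (i : ℕ) :
    f ^ i ∈ poleLE W (i * n) := by
  rw [mem_poleLE, poleOrder, map_pow]
  exact natDegree_pow_le_of_le i hf

lemma translateX_mem_poleLE (a b : k) : translateX W a b ∈ poleLE W 4 := by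
  rw [← sub_add_cancel (translateX W a b)
    (algebraMap k[X] W.CoordinateRing (C a) * XClass W a ^ 2)]
  exact add_mem (poleLE_mono (by lia) (translateX_sub_mem_poleLE a b))
    (C_mul_mem_poleLE a (pow_mem_poleLE (XClass_mem_poleLE a) 2))

lemma translateY_mem_poleLE (a b : k) : translateY W a b ∈ poleLE W 6 := by
  refine sub_mem (sub_mem (neg_mem ?_) ?_) ?_
  · exact mul_mem_poleLE (YClass_C_mem_poleLE b) (translateX_sub_mem_poleLE a b)
  · exact C_mul_mem_poleLE _ (pow_mem_poleLE (XClass_mem_poleLE a) 3)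
  · exact mul_mem_poleLE (C_mul_mem_poleLE _ (XClass_mem_poleLE a)) (translateX_mem_poleLE a b)

lemma XClass_mem_XYIdeal (a b : k) : XClass W a ∈ XYIdeal W a (C b) :=
  Ideal.subset_span (by simp)

lemma YClass_mem_XYIdeal (a b : k) : YClass W (C b) ∈ XYIdeal W a (C b) :=
  Ideal.subset_span (by simp)

lemma translateX_mem_XYIdeal_pow (a b : k) : translateX W a b ∈ XYIdeal W a (C b) ^ 2 := by
  refine sub_mem (add_mem ?_ ?_) ?_
  · exact Ideal.pow_mem_pow (YClass_mem_XYIdeal a b) 2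
  · rw [mul_assoc, sq]
    exact Ideal.mul_mem_left _ _
      (Ideal.mul_mem_mul (YClass_mem_XYIdeal a b) (XClass_mem_XYIdeal a b))
  · exact Ideal.mul_mem_left _ _ (Ideal.pow_mem_pow (XClass_mem_XYIdeal a b) 2)

lemma translateY_mem_XYIdeal_pow (a b : k) : translateY W a b ∈ XYIdeal W a (C b) ^ 3 := by
  refine sub_mem (sub_mem (neg_mem ?_) ?_) ?_
  · rw [pow_succ']
    exact Ideal.mul_mem_mul (YClass_mem_XYIdeal a b) (sub_mem (translateX_mem_XYIdeal_pow a b)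
      (Ideal.mul_mem_left _ _ (Ideal.pow_mem_pow (XClass_mem_XYIdeal a b) 2)))
  · exact Ideal.mul_mem_left _ _ (Ideal.pow_mem_pow (XClass_mem_XYIdeal a b) 3)
  · rw [mul_assoc, pow_succ']
    exact Ideal.mul_mem_left _ _
      (Ideal.mul_mem_mul (XClass_mem_XYIdeal a b) (translateX_mem_XYIdeal_pow a b))

lemma evalAt_translateX [DecidableEq k] {x y a b : k} (h : W.Equation x y) (hx : x ≠ a) :
    evalAt h (translateX W a b) = (x - a) ^ 2 * W.addX x a (W.slope x a y b) := by
  have hx' : x - a ≠ 0 := sub_ne_zero.mpr hx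
  simp only [translateX, map_sub, map_add, map_mul, map_pow, evalAt_algebraMap, evalAt_XClass,
    evalAt_YClass_C, eval_C, eval_X, addX, slope_of_X_ne hx]
  field_simp
  ring

lemma evalAt_translateY [DecidableEq k] {x y a b : k} (h : W.Equation x y) (hx : x ≠ a) :
    evalAt h (translateY W a b) = (x - a) ^ 3 * W.addY x a y (W.slope x a y b) := by
  have hx' : x - a ≠ 0 := sub_ne_zero.mpr hx
  rw [translateY]
  simp only [map_sub, map_mul, map_pow, map_neg, evalAt_algebraMap, evalAt_XClass,
    evalAt_YClass_C, eval_C, addY, negAddY, negY, evalAt_translateX h hx]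
  rw [slope_of_X_ne hx]
  field_simp
  ring

end CoordinateRing

open CoordinateRing

namespace Point

/-- The value of a regular function at a point, with value `0` at infinity. -/
noncomputable def eval : W.Point → W.CoordinateRing →ₗ[k] k
  | 0 => 0
  | some _ _ h => (evalAt h.1).toLinearMap

lemma eval_zero : eval (0 : W.Point) = 0 := rfl

lemma eval_some {x y : k} (h : W.Nonsingular x y) (f : W.CoordinateRing) :
    eval (some x y h) f = evalAt h.1 f := rfl

lemma eval_mul (P : W.Point) (f g : W.CoordinateRing) :
    P.eval (f * g) = P.eval f * P.eval g := by
  match P with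
  | 0 => simp [eval_zero]
  | some _ _ h => simp [eval_some]

lemma eval_one {P : W.Point} (hP : P ≠ 0) : P.eval 1 = 1 := by
  match P with
  | 0 => exact absurd rfl hP
  | some _ _ h => simp [eval_some]

lemma eval_neg {P : W.Point} (f : W.CoordinateRing) : (-P).eval f = P.eval (conj W f) := by
  match P with
  | 0 => rfl
  | some x y h =>
    obtain ⟨p, q, rfl⟩ := exists_smul_basis_eq f
    rw [neg_some, conj_smul_basis]
    simp only [eval_some, map_add, evalAt_smul, evalAt_mk_Y, map_one, negY]
    simp
    ring

end Point

variable [DecidableEq k]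

/-- The regular functions `f` whose translate by the point `(a, b)` is the quotient by
`(X - a) ^ n` of a regular function in the `n`-th power of the ideal of `(a, b)` with a
pole of order at most `2 * n` at infinity. -/
noncomputable def translatable {a b : k} (hQ : W.Nonsingular a b) (n : ℕ) :
    Submodule k W.CoordinateRing where
  carrier := {f | ∃ g ∈ poleLE W (2 * n), g ∈ XYIdeal W a (C b) ^ n ∧
    ∀ (x y : k) (h : W.Nonsingular x y), x ≠ a →
      evalAt h.1 g = (x - a) ^ n * (Point.some x y h + Point.some a b hQ).eval f}
  zero_mem' := ⟨0, zero_mem _, zero_mem _, by simp⟩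
  add_mem' := by
    rintro f g ⟨F, hF, hF', hF''⟩ ⟨G, hG, hG', hG''⟩
    refine ⟨F + G, add_mem hF hG, add_mem hF' hG', fun x y h hx => ?_⟩
    rw [map_add, map_add, hF'' x y h hx, hG'' x y h hx, mul_add]
  smul_mem' := by
    rintro c f ⟨F, hF, hF', hF''⟩
    refine ⟨c • F, Submodule.smul_mem _ c hF, ?_, fun x y h hx => ?_⟩
    · rw [Algebra.smul_def]
      exact Ideal.mul_mem_left _ _ hF'
    · rw [map_smul, map_smul, hF'' x y h hx, smul_eq_mul, smul_eq_mul]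
      ring

lemma mul_mem_translatable {a b : k} {hQ : W.Nonsingular a b} {m n : ℕ} {f g : W.CoordinateRing}
    (hf : f ∈ translatable hQ m) (hg : g ∈ translatable hQ n) :
    f * g ∈ translatable hQ (m + n) := by
  obtain ⟨F, hF, hF', hF''⟩ := hf
  obtain ⟨G, hG, hG', hG''⟩ := hg
  refine ⟨F * G, mul_add 2 m n ▸ mul_mem_poleLE hF hG, ?_, fun x y h hx => ?_⟩
  · rw [pow_add]
    exact Ideal.mul_mem_mul hF' hG'
  · rw [map_mul, Point.eval_mul, hF'' x y h hx, hG'' x y h hx, pow_add]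
    ring

lemma one_mem_translatable {a b : k} (hQ : W.Nonsingular a b) (n : ℕ) :
    1 ∈ translatable hQ n := by
  refine ⟨XClass W a ^ n, mul_comm n 2 ▸ pow_mem_poleLE (XClass_mem_poleLE a) n,
    Ideal.pow_mem_pow (XClass_mem_XYIdeal a b) n, fun x y h hx => ?_⟩
  rw [map_pow, evalAt_XClass, Point.add_of_X_ne hx, Point.eval_one (Point.some_ne_zero _), mul_one]

lemma X_mem_translatable {a b : k} (hQ : W.Nonsingular a b) :
    algebraMap k[X] W.CoordinateRing X ∈ translatable hQ 2 := by
  refine ⟨translateX W a b, translateX_mem_poleLE a b, translateX_mem_XYIdeal_pow a b,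
    fun x y h hx => ?_⟩
  rw [evalAt_translateX h.1 hx, Point.add_of_X_ne hx, Point.eval_some, evalAt_algebraMap, eval_X]

lemma Y_mem_translatable {a b : k} (hQ : W.Nonsingular a b) :
    CoordinateRing.mk W X ∈ translatable hQ 3 := by
  refine ⟨translateY W a b, translateY_mem_poleLE a b, translateY_mem_XYIdeal_pow a b,
    fun x y h hx => ?_⟩
  rw [evalAt_translateY h.1 hx, Point.add_of_X_ne hx, Point.eval_some, evalAt_mk_Y]

lemma translatable_mono {a b : k} (hQ : W.Nonsingular a b) {m n : ℕ} (h : m ≤ n) :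
    translatable hQ m ≤ translatable hQ n := fun f hf => by
  rw [← Nat.add_sub_of_le h, ← mul_one f]
  exact mul_mem_translatable hf (one_mem_translatable hQ _)

lemma algebraMap_mem_translatable {a b : k} (hQ : W.Nonsingular a b) (p : k[X]) :
    algebraMap k[X] W.CoordinateRing p ∈ translatable hQ (2 * p.natDegree) := by
  have hpow (i : ℕ) : algebraMap k[X] W.CoordinateRing X ^ i ∈ translatable hQ (2 * i) := by
    induction i with
    | zero => rw [pow_zero]; exact one_mem_translatable hQ _
    | succ i ih => rw [pow_succ]; exact mul_mem_translatable ih (X_mem_translatable hQ)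
  have h := congrArg (algebraMap k[X] W.CoordinateRing) p.as_sum_range_C_mul_X_pow
  rw [h, map_sum]
  refine sum_mem fun i hi => ?_
  rw [map_mul, map_pow, ← smul_eq_algebraMap_C_mul]
  exact Submodule.smul_mem _ _ (translatable_mono hQ (by grind) (hpow i))

/-- The generators `X` and `Y` are translatable at levels 2 and 3, exactly their pole orders, and
levels add under products. -/
lemma poleLE_le_translatable {a b : k} (hQ : W.Nonsingular a b) (n : ℕ) :
    poleLE W n ≤ translatable hQ n := fun f hf => by
  obtain ⟨p, q, rfl⟩ := exists_smul_basis_eq f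
  rw [mem_poleLE, poleOrder_smul_basis_le_iff] at hf
  refine add_mem ?_ ?_
  · rw [← Algebra.algebraMap_eq_smul_one]
    exact translatable_mono hQ hf.1 (algebraMap_mem_translatable hQ p)
  · rcases hf.2 with rfl | hq
    · rw [zero_smul]
      exact zero_mem _
    · rw [Algebra.smul_def]
      exact translatable_mono hQ hq
        (mul_mem_translatable (algebraMap_mem_translatable hQ q) (Y_mem_translatable hQ))

end WeierstrassCurve.Affine

end

/-! ### Principal ideals attached to torsion points, and counting zeros. -/

section

open Polynomial Filter

namespace WeierstrassCurve.Affine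

variable {k : Type*} [Field k] {W : Affine k}

open CoordinateRing

namespace CoordinateRing

lemma poleOrder_pow (f : W.CoordinateRing) (n : ℕ) : poleOrder (f ^ n) = n * poleOrder f := by
  rw [poleOrder, map_pow, natDegree_pow, poleOrder]

lemma poleOrder_le_of_dvd {f g : W.CoordinateRing} (h : f ∣ g) (hg : g ≠ 0) :
    poleOrder f ≤ poleOrder g := by
  obtain ⟨c, rfl⟩ := h
  rw [poleOrder_mul (left_ne_zero_of_mul hg) (right_ne_zero_of_mul hg)]
  exact Nat.le_add_right ..

lemma poleOrder_eq_of_span_eq {f g : W.CoordinateRing} (h : Ideal.span {f} = Ideal.span {g})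
    (hg : g ≠ 0) : poleOrder f = poleOrder g := by
  have hf : f ≠ 0 := by
    rintro rfl
    rw [Ideal.span_singleton_eq_span_singleton] at h
    exact hg (h.eq_zero_iff.mp rfl)
  rw [Ideal.span_singleton_eq_span_singleton] at h
  exact le_antisymm (poleOrder_le_of_dvd h.dvd hg) (poleOrder_le_of_dvd h.symm.dvd hf)

lemma poleOrder_XClass (a : k) : poleOrder (XClass W a) = 2 := by
  rw [XClass_eq, poleOrder_algebraMap, natDegree_X_sub_C]

end CoordinateRing

variable [DecidableEq k]

/-- The power of the ideal of a torsion point is principal. -/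
lemma exists_XYIdeal_pow_eq_span {a b : k} (hR : W.Nonsingular a b) {n : ℕ}
    (hn : n • Point.some a b hR = 0) :
    ∃ f : W.CoordinateRing, f ≠ 0 ∧ XYIdeal W a (C b) ^ n = Ideal.span {f} := by
  have h := congrArg Point.toClass hn
  rw [map_nsmul, Point.toClass_some, map_zero] at h
  have h' : ClassGroup.mk W.FunctionField (XYIdeal' (W := W) hR ^ n) = 1 := by
    rw [map_pow]
    exact h
  refine (ClassGroup.mk_eq_one_of_coe_ideal ?_).mp h'
  rw [Units.val_pow_eq_pow_val, XYIdeal'_eq, FractionalIdeal.coeIdeal_pow]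

/-- The ideals of `R` and `-R` have product `(X - a)`, and `conj` exchanges them. So the generators
of their `n`-th powers are conjugate, have equal pole orders, and these add up to `2 * n`. Here `f`
vanishes at `-R` and `g` at `R`. -/
lemma exists_generators {a b : k} (hR : W.Nonsingular a b) {n : ℕ}
    (hn : n • Point.some a b hR = 0) :
    ∃ f g : W.CoordinateRing, XYIdeal W a (C (W.negY a b)) ^ n = Ideal.span {f} ∧
      f * g = XClass W a ^ n ∧ poleOrder f = n ∧ poleOrder g = n := by
  obtain ⟨g, hg0, hg⟩ := exists_XYIdeal_pow_eq_span hR hn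
  have hX : XClass W a ^ n ≠ 0 := pow_ne_zero n (XClass_ne_zero a)
  have hf : XYIdeal W a (C (W.negY a b)) ^ n = Ideal.span {conj W g} := by
    rw [← map_conj_XYIdeal, ← Ideal.map_pow, hg, Ideal.map_span, Set.image_singleton]
  have hfg : Ideal.span {conj W g * g} = Ideal.span {XClass W a ^ n} := by
    rw [← Ideal.span_singleton_mul_span_singleton, ← hf, ← hg, ← mul_pow, XYIdeal_neg_mul hR,
      XIdeal, Ideal.span_singleton_pow]
  have hf0 : conj W g ≠ 0 := fun h => hg0 (by rw [← conj_conj g, h, map_zero])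
  have hdeg := poleOrder_eq_of_span_eq hfg hX
  rw [poleOrder_mul hf0 hg0, poleOrder_conj, poleOrder_pow, poleOrder_XClass] at hdeg
  obtain ⟨u, hu⟩ := Ideal.span_singleton_eq_span_singleton.mp hfg
  have hspan : Ideal.span {g * u} = Ideal.span {g} :=
    Ideal.span_singleton_eq_span_singleton.mpr (associated_mul_unit_left g u u.isUnit)
  -- The unit `u` turns equality of ideals into the exact equality `f * g = (X - a) ^ n`.
  refine ⟨conj W g, g * u, hf, by rw [← mul_assoc, hu], ?_, ?_⟩
  · rw [poleOrder_conj]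
    lia
  · rw [poleOrder_eq_of_span_eq hspan hg0]
    lia

/-- For an `n`-torsion point `R`, multiplication by a generator of the `n`-th power of the ideal
of `R`, after translation by `R`, preserves the functions whose pole at infinity has order at
most `n`. -/
lemma exists_translation_multiplier {R : W.Point} {n : ℕ} (hn : n • R = 0) :
    ∃ g : W.CoordinateRing, (R ≠ 0 → poleOrder g = n) ∧
      (∀ X : W.Point, X ≠ 0 → X ≠ R → X ≠ -R → X.eval g ≠ 0) ∧
      ∀ h ∈ poleLE W n, ∃ q ∈ poleLE W n, ∀ X : W.Point, X ≠ 0 → X ≠ R → X ≠ -R →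
        X.eval g * (X - R).eval h = X.eval q := by
  match R with
  | 0 =>
    refine ⟨1, fun h => absurd rfl h, fun X hX _ _ => ?_, fun h hh => ⟨h, hh, fun X hX _ _ => ?_⟩⟩
    · rw [Point.eval_one hX]
      exact one_ne_zero
    · rw [Point.eval_one hX, sub_zero, one_mul]
  | .some a b hR =>
    obtain ⟨f, g, hf, hfg, hfn, hgn⟩ := exists_generators hR hn
    have hne (x y : k) (h : W.Nonsingular x y) (h1 : Point.some x y h ≠ Point.some a b hR)
        (h2 : Point.some x y h ≠ -Point.some a b hR) : x ≠ a := fun hx =>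
      (Point.X_eq_iff.mp hx).elim h1 h2
    have hval (x y : k) (h : W.Nonsingular x y) :
        evalAt h.1 f * evalAt h.1 g = (x - a) ^ n := by
      rw [← map_mul, hfg, map_pow, evalAt_XClass]
    refine ⟨g, fun _ => hgn, fun X h0 h1 h2 => ?_, fun h hh => ?_⟩
    · match X with
      | 0 => exact absurd rfl h0
      | .some x y h =>
        exact right_ne_zero_of_mul
          (hval x y h ▸ pow_ne_zero n (sub_ne_zero.mpr (hne x y h h1 h2)))
    -- Translating by `-R` gives `B = (X - a) ^ n * h(· - R)`, divisible by the generator `f` of the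
    -- `n`-th power of the ideal of `-R`. The quotient is `g * h(· - R)`, of pole order at most `2 *
    -- n - n`.
    · obtain ⟨B, hB, hBI, hBv⟩ := poleLE_le_translatable ((nonsingular_neg a b).mpr hR) n hh
      rw [hf, Ideal.mem_span_singleton] at hBI
      obtain ⟨q, rfl⟩ := hBI
      have hf0 : f ≠ 0 := left_ne_zero_of_mul (hfg ▸ pow_ne_zero n (XClass_ne_zero a))
      refine ⟨q, ?_, fun X h0 h1 h2 => ?_⟩
      · by_cases hq : q = 0
        · exact hq ▸ zero_mem _
        · rw [mem_poleLE, poleOrder_mul hf0 hq] at hB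
          rw [mem_poleLE]
          lia
      · match X with
        | 0 => exact absurd rfl h0
        | .some x y h' =>
          have hx := hne x y h' h1 h2
          have hv := hBv x y h' hx
          have hpow : (x - a) ^ n ≠ 0 := pow_ne_zero n (sub_ne_zero.mpr hx)
          rw [map_mul, ← hval x y h', mul_assoc] at hv
          rw [← hval x y h'] at hpow
          exact (mul_left_cancel₀ (left_ne_zero_of_mul hpow) hv).symm

/-- A regular function has at most twice as many zeros as the order of its pole. -/
lemma card_zeros_le {f : W.CoordinateRing} (hf : f ≠ 0) (s : Finset W.Point)
    (hs : ∀ P ∈ s, P ≠ 0 ∧ P.eval f = 0) : s.card ≤ 2 * poleOrder f := by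
  classical
  let xc : W.Point → k := fun P => P.xRep 0
  have hroots : s.image xc ⊆ (Algebra.norm k[X] f).roots.toFinset := by
    intro x hx
    obtain ⟨P, hP, rfl⟩ := Finset.mem_image.mp hx
    obtain ⟨h0, h1⟩ := hs P hP
    match P with
    | 0 => exact absurd rfl h0
    | .some x y h =>
      rw [Multiset.mem_toFinset, mem_roots (norm_ne_zero hf), IsRoot.def]
      change (Algebra.norm k[X] f).eval x = 0
      rw [← evalAt_algebraMap h.1, ← mul_conj, map_mul]
      rw [Point.eval_some] at h1
      rw [h1, zero_mul]
  have hcard : (s.image xc).card ≤ poleOrder f :=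
    (Finset.card_le_card hroots).trans ((Multiset.toFinset_card_le _).trans (card_roots' _))
  -- The norm bounds only the number of abscissas, each shared by at most the two points `P` and
  -- `-P`; hence the factor 2.
  refine (Finset.card_le_mul_card_image s 2 fun x hx => ?_).trans
    (Nat.mul_le_mul_left 2 hcard)
  obtain ⟨P, hP, rfl⟩ := Finset.mem_image.mp hx
  refine (Finset.card_le_card (t := {P, -P}) fun Q hQ => ?_).trans Finset.card_le_two
  rw [Finset.mem_filter] at hQ
  have hP0 := (hs P hP).1
  have hQ0 := (hs Q hQ.1).1
  rw [Finset.mem_insert, Finset.mem_singleton]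
  match P, Q, hQ with
  | 0, _, _ => exact absurd rfl hP0
  | _, 0, _ => exact absurd rfl hQ0
  | .some x y h, .some x' y' h', hQ => exact Point.X_eq_iff.mp hQ.2

lemma eventually_eval_ne_zero {f : W.CoordinateRing} (hf : f ≠ 0) :
    ∀ᶠ P : W.Point in cofinite, P.eval f ≠ 0 := by
  rw [eventually_cofinite]
  by_contra hinf
  have hinf' : ({P : W.Point | ¬P.eval f ≠ 0} \ {0}).Infinite :=
    Set.Infinite.sdiff hinf (Set.finite_singleton 0)
  obtain ⟨t, ht, htc⟩ := hinf'.exists_subset_card_eq (2 * poleOrder f + 1)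
  have := card_zeros_le hf t fun P hP => ⟨(ht hP).2, not_not.mp (ht hP).1⟩
  lia

omit [DecidableEq k] in
lemma eventually_ne (P : W.Point) : ∀ᶠ X : W.Point in cofinite, X ≠ P :=
  (Set.finite_singleton P).subset fun _ h => not_not.mp h

lemma tendsto_sub_cofinite (R : W.Point) :
    Tendsto (fun X : W.Point => X - R) cofinite cofinite :=
  sub_left_injective.tendsto_cofinite

section IsAlgClosed

variable [IsAlgClosed k] [W.IsElliptic]

variable (W) in
omit [DecidableEq k] in
lemma exists_nonsingular (x : k) : ∃ y : k, W.Nonsingular x y := by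
  have hdeg : (X ^ 2 + C (W.a₁ * x + W.a₃) * X -
      C (x ^ 3 + W.a₂ * x ^ 2 + W.a₄ * x + W.a₆)).degree ≠ 0 := by
    have h : (X ^ 2 + C (W.a₁ * x + W.a₃) * X -
      C (x ^ 3 + W.a₂ * x ^ 2 + W.a₄ * x + W.a₆)).degree = 2 := by compute_degree!
    rw [h]
    exact two_ne_zero
  obtain ⟨y, hy⟩ := IsAlgClosed.exists_root (X ^ 2 + C (W.a₁ * x + W.a₃) * X -
    C (x ^ 3 + W.a₂ * x ^ 2 + W.a₄ * x + W.a₆)) hdeg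
  refine ⟨y, equation_iff_nonsingular.mp ((equation_iff x y).mpr ?_)⟩
  simp only [IsRoot.def, eval_sub, eval_add, eval_mul, eval_pow, eval_X, eval_C] at hy
  linear_combination hy

instance : Infinite W.Point := by
  choose y hy using exists_nonsingular W
  have : Infinite k := IsAlgClosed.instInfinite
  refine Infinite.of_injective (fun x => Point.some x (y x) (hy x)) fun x x' h => ?_
  exact (Point.some.inj h).1

lemma eq_of_eventually_eval_eq {f g : W.CoordinateRing}
    (h : ∀ᶠ P : W.Point in cofinite, P.eval f = P.eval g) : f = g := by
  by_contra hne
  obtain ⟨P, h1, h2⟩ := (h.and (eventually_eval_ne_zero (sub_ne_zero.mpr hne))).exists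
  exact h2 (by rw [map_sub, h1, sub_self])

/-- A root of the norm is the abscissa of some point `P`, and the norm there is `f(P) * f(-P)`. -/
lemma exists_zero {f : W.CoordinateRing} (hf : 0 < poleOrder f) :
    ∃ P : W.Point, P ≠ 0 ∧ P.eval f = 0 := by
  obtain ⟨x, hx⟩ := IsAlgClosed.exists_root (Algebra.norm k[X] f)
    (ne_of_gt (natDegree_pos_iff_degree_pos.mp hf))
  obtain ⟨y, h⟩ := exists_nonsingular W x
  have hz : (Point.some x y h).eval f * (-Point.some x y h).eval f = 0 := by
    rw [Point.eval_neg, ← Point.eval_mul, mul_conj, Point.eval_some, evalAt_algebraMap]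
    exact hx
  rcases mul_eq_zero.mp hz with h0 | h0
  · exact ⟨_, Point.some_ne_zero h, h0⟩
  · exact ⟨_, neg_ne_zero.mpr (Point.some_ne_zero h), h0⟩

end IsAlgClosed

end WeierstrassCurve.Affine

end

/-! ### Theta functions and the Weil pairing. -/

section

open Polynomial Filter

namespace WeierstrassCurve.Affine

variable {k : Type*} [Field k] {W : Affine k}

open CoordinateRing

lemma CoordinateRing.one_mem_poleLE (n : ℕ) : (1 : W.CoordinateRing) ∈ poleLE W n := by
  rw [← map_one (algebraMap k[X] W.CoordinateRing)]
  exact algebraMap_mem_poleLE (by simp)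

/-- A bound on the pole bounds the degrees of both coordinates in the basis `1, Y`. Finite dimension
is what provides eigenvectors below. -/
instance (n : ℕ) : FiniteDimensional k (poleLE W n) := by
  let φ : k[X] × k[X] →ₗ[k] W.CoordinateRing :=
    LinearMap.coprod ((LinearMap.toSpanSingleton k[X] W.CoordinateRing 1).restrictScalars k)
      ((LinearMap.toSpanSingleton k[X] W.CoordinateRing (CoordinateRing.mk W X)).restrictScalars k)
  have hfin : FiniteDimensional k (((degreeLT k (n + 1)).prod (degreeLT k (n + 1))).map φ) := by
    have h1 : FiniteDimensional k (degreeLT k (n + 1)) :=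
      Module.Finite.equiv (degreeLTEquiv k (n + 1)).symm
    have h2 : ((degreeLT k (n + 1)).prod (degreeLT k (n + 1))).FG :=
      (Module.Finite.iff_fg.mp h1).prod (Module.Finite.iff_fg.mp h1)
    exact Module.Finite.iff_fg.mpr (h2.map φ)
  refine Submodule.finiteDimensional_of_le (S₂ := ((degreeLT k (n + 1)).prod
    (degreeLT k (n + 1))).map φ) fun f hf => ?_
  obtain ⟨p, q, rfl⟩ := exists_smul_basis_eq f
  rw [mem_poleLE, poleOrder_smul_basis_le_iff] at hf
  refine ⟨(p, q), ⟨?_, ?_⟩, rfl⟩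
  · exact mem_degreeLT.mpr ((degree_le_natDegree).trans_lt (by norm_cast; lia))
  · rcases hf.2 with rfl | hq
    · exact zero_mem _
    · exact mem_degreeLT.mpr ((degree_le_natDegree).trans_lt (by norm_cast; lia))

variable [DecidableEq k]

/-- A function on the points, considered up to finitely many points, which has finitely many
zeros and such that translation by `R` followed by multiplication by it preserves the space of
regular functions whose pole at infinity has order at most `n`. -/
def IsTheta (n : ℕ) (R : W.Point) (f : W.Point → k) : Prop :=
  (∀ᶠ X in cofinite, f X ≠ 0) ∧ ∀ h ∈ poleLE W n, ∃ q ∈ poleLE W n,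
    ∀ᶠ X in cofinite, f X * (X - R).eval h = X.eval q

lemma exists_isTheta {n : ℕ} {R : W.Point} (hn : n • R = 0) :
    ∃ g : W.CoordinateRing, (R ≠ 0 → poleOrder g = n) ∧ IsTheta n R (fun X => X.eval g) ∧
      ∀ h ∈ poleLE W n, ∃ q ∈ poleLE W n, ∀ X : W.Point, X ≠ 0 → X ≠ R → X ≠ -R →
        X.eval g ≠ 0 ∧ X.eval g * (X - R).eval h = X.eval q := by
  obtain ⟨g, hg, hne, hq⟩ := exists_translation_multiplier hn
  refine ⟨g, hg, ⟨?_, fun h hh => ?_⟩, fun h hh => ?_⟩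
  · filter_upwards [eventually_ne 0, eventually_ne R, eventually_ne (-R)] using hne
  · obtain ⟨q, hqV, hqX⟩ := hq h hh
    refine ⟨q, hqV, ?_⟩
    filter_upwards [eventually_ne 0, eventually_ne R, eventually_ne (-R)] using hqX
  · obtain ⟨q, hqV, hqX⟩ := hq h hh
    exact ⟨q, hqV, fun X h0 h1 h2 => ⟨hne X h0 h1 h2, hqX X h0 h1 h2⟩⟩

namespace IsTheta

/-- This is composition of the twisted translations by `R` and by `S`. -/
lemma add {n : ℕ} {R S : W.Point} {f g : W.Point → k} (hf : IsTheta n R f) (hg : IsTheta n S g) :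
    IsTheta n (R + S) (fun X => f X * g (X - R)) := by
  refine ⟨?_, fun h hh => ?_⟩
  · filter_upwards [hf.1, (tendsto_sub_cofinite R).eventually hg.1] with X h1 h2
    exact mul_ne_zero h1 h2
  · obtain ⟨q, hq, hqX⟩ := hg.2 h hh
    obtain ⟨r, hr, hrX⟩ := hf.2 q hq
    refine ⟨r, hr, ?_⟩
    filter_upwards [(tendsto_sub_cofinite R).eventually hqX, hrX] with X h1 h2
    rw [← h2, ← h1, ← sub_sub, mul_assoc]

lemma zero_one (n : ℕ) : IsTheta n (0 : W.Point) (fun _ => 1) :=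
  ⟨Eventually.of_forall fun _ => one_ne_zero, fun h hh => ⟨h, hh, Eventually.of_forall fun X => by
    rw [one_mul, sub_zero]⟩⟩

variable [IsAlgClosed k] [W.IsElliptic]

/-- The operator on functions with bounded pole at infinity attached to a theta function. -/
noncomputable def op {n : ℕ} {R : W.Point} {f : W.Point → k} (hf : IsTheta n R f) :
    poleLE W n →ₗ[k] poleLE W n where
  toFun h := ⟨(hf.2 h h.2).choose, (hf.2 h h.2).choose_spec.1⟩
  map_add' h h' := by
    refine Subtype.ext (eq_of_eventually_eval_eq ?_)
    filter_upwards [(hf.2 _ (h + h').2).choose_spec.2, (hf.2 _ h.2).choose_spec.2,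
      (hf.2 _ h'.2).choose_spec.2] with X h1 h2 h3
    refine h1.symm.trans (Eq.trans ?_ (map_add (X.eval) _ _).symm)
    rw [Submodule.coe_add, map_add, mul_add, h2, h3]
  map_smul' c h := by
    refine Subtype.ext (eq_of_eventually_eval_eq ?_)
    filter_upwards [(hf.2 _ (c • h).2).choose_spec.2, (hf.2 _ h.2).choose_spec.2] with X h1 h2
    refine h1.symm.trans (Eq.trans ?_ (map_smul (X.eval) _ _).symm)
    rw [Submodule.coe_smul, map_smul, smul_eq_mul, mul_left_comm, h2]
    rfl

lemma op_spec {n : ℕ} {R : W.Point} {f : W.Point → k} (hf : IsTheta n R f) (h : poleLE W n) :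
    ∀ᶠ X in cofinite, f X * (X - R).eval (h : W.CoordinateRing) = X.eval (hf.op h : _) :=
  (hf.2 h h.2).choose_spec.2

lemma op_injective {n : ℕ} {R : W.Point} {f : W.Point → k} (hf : IsTheta n R f) :
    Function.Injective hf.op := by
  refine (injective_iff_map_eq_zero _).mpr fun h hh => ?_
  by_contra hne
  have hne' : (h : W.CoordinateRing) ≠ 0 := fun h0 => hne (Subtype.ext h0)
  obtain ⟨X, h1, h2, h3⟩ := (hf.1.and ((hf.op_spec h).and
    ((tendsto_sub_cofinite R).eventually (eventually_eval_ne_zero hne')))).exists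
  rw [hh, Submodule.coe_zero, map_zero] at h2
  exact mul_ne_zero h1 h3 h2

instance (n : ℕ) : Nontrivial (poleLE W n) :=
  ⟨⟨⟨1, one_mem_poleLE n⟩, 0, fun h => one_ne_zero (congrArg Subtype.val h)⟩⟩

/-- An eigenvector `h` of `hg.op⁻¹ ∘ hf.op` satisfies `f * h(· - R) = c * g * h(· - R)`, and the
nonzero regular function `h` can be cancelled away from its finitely many zeros. -/
lemma exists_eq_mul {n : ℕ} {R : W.Point} {f g : W.Point → k} (hf : IsTheta n R f)
    (hg : IsTheta n R g) : ∃ c : k, c ≠ 0 ∧ ∀ᶠ X in cofinite, f X = c * g X := by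
  let e := LinearEquiv.ofInjectiveEndo hg.op hg.op_injective
  obtain ⟨c, hc⟩ := Module.End.exists_eigenvalue ((e.symm : poleLE W n →ₗ[k] poleLE W n) ∘ₗ hf.op)
  obtain ⟨h, hh⟩ := hc.exists_hasEigenvector
  have hev : hf.op h = c • hg.op h := by
    have := congrArg e hh.apply_eq_smul
    rwa [LinearMap.comp_apply, LinearEquiv.coe_coe, LinearEquiv.apply_symm_apply, map_smul] at this
  have hne' : (h : W.CoordinateRing) ≠ 0 := fun h0 => hh.2 (Subtype.ext h0)
  have key : ∀ᶠ X in cofinite, f X = c * g X := by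
    filter_upwards [hf.op_spec h, hg.op_spec h,
      (tendsto_sub_cofinite R).eventually (eventually_eval_ne_zero hne')] with X h1 h2 h3
    rw [hev, Submodule.coe_smul, map_smul, ← h2, smul_eq_mul, ← mul_assoc] at h1
    exact mul_right_cancel₀ h3 h1
  refine ⟨c, ?_, key⟩
  rintro rfl
  obtain ⟨X, h1, h2⟩ := (key.and hf.1).exists
  exact h2 (by rw [h1, zero_mul])

end IsTheta

variable [IsAlgClosed k] [W.IsElliptic]

/-- The Weil pairing, as the commutator of theta functions. -/
noncomputable def weilPairing (n : ℕ) (S T : W.Point) : k :=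
  Classical.epsilon fun ζ => ∀ f g : W.Point → k, IsTheta n S f → IsTheta n T g →
    ∀ᶠ X in cofinite, f X * g (X - S) = ζ * (g X * f (X - T))

section

variable {n : ℕ} {S T : W.Point}

/-- Composing in either order gives theta functions for `S + T`, proportional by uniqueness.
Rescaling `f` or `g` affects both sides equally, so the constant depends only on the points. -/
lemma weilPairing_spec (hS : n • S = 0) (hT : n • T = 0) {f g : W.Point → k}
    (hf : IsTheta n S f) (hg : IsTheta n T g) :
    ∀ᶠ X in cofinite, f X * g (X - S) = weilPairing n S T * (g X * f (X - T)) := by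
  refine Classical.epsilon_spec (p := fun ζ => ∀ f g : W.Point → k, IsTheta n S f →
    IsTheta n T g → ∀ᶠ X in cofinite, f X * g (X - S) = ζ * (g X * f (X - T))) ?_ f g hf hg
  obtain ⟨f₀, -, hf₀, -⟩ := exists_isTheta hS
  obtain ⟨g₀, -, hg₀, -⟩ := exists_isTheta hT
  obtain ⟨ζ, -, hζ⟩ := (hf₀.add hg₀).exists_eq_mul (add_comm T S ▸ hg₀.add hf₀)
  refine ⟨ζ, fun f g hf hg => ?_⟩
  obtain ⟨c, -, hc⟩ := hf.exists_eq_mul hf₀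
  obtain ⟨d, -, hd⟩ := hg.exists_eq_mul hg₀
  filter_upwards [hζ, hc, hd, (tendsto_sub_cofinite T).eventually hc,
    (tendsto_sub_cofinite S).eventually hd] with X h1 h2 h3 h4 h5
  rw [h2, h3, h4, h5]
  linear_combination c * d * h1

lemma weilPairing_eq (hS : n • S = 0) (hT : n • T = 0) {f g : W.Point → k}
    (hf : IsTheta n S f) (hg : IsTheta n T g) {ζ : k}
    (h : ∀ᶠ X in cofinite, f X * g (X - S) = ζ * (g X * f (X - T))) : weilPairing n S T = ζ := by
  obtain ⟨X, h1, h2, h3, h4⟩ := (h.and ((weilPairing_spec hS hT hf hg).and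
    (hg.1.and ((tendsto_sub_cofinite T).eventually hf.1)))).exists
  exact mul_right_cancel₀ (mul_ne_zero h3 h4) (h2.symm.trans h1)

lemma weilPairing_add_right {T' : W.Point} (hS : n • S = 0) (hT : n • T = 0) (hT' : n • T' = 0) :
    weilPairing n S (T + T') = weilPairing n S T * weilPairing n S T' := by
  obtain ⟨f, -, hf, -⟩ := exists_isTheta hS
  obtain ⟨g, -, hg, -⟩ := exists_isTheta hT
  obtain ⟨g', -, hg', -⟩ := exists_isTheta hT'
  refine weilPairing_eq hS (by rw [smul_add, hT, hT', add_zero]) hf (hg.add hg') ?_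
  filter_upwards [weilPairing_spec hS hT hf hg,
    (tendsto_sub_cofinite T).eventually (weilPairing_spec hS hT' hf hg')] with X h1 h2
  rw [sub_right_comm X T S] at h2
  rw [← sub_sub X T T']
  linear_combination h1 * (X - S - T).eval g' + weilPairing n S T * X.eval g * h2

lemma weilPairing_mul_swap (hS : n • S = 0) (hT : n • T = 0) :
    weilPairing n S T * weilPairing n T S = 1 := by
  obtain ⟨f, -, hf, -⟩ := exists_isTheta hS
  obtain ⟨g, -, hg, -⟩ := exists_isTheta hT
  obtain ⟨X, h1, h2, h3, h4⟩ := ((weilPairing_spec hS hT hf hg).and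
    ((weilPairing_spec hT hS hg hf).and
    (hg.1.and ((tendsto_sub_cofinite T).eventually hf.1)))).exists
  refine mul_right_cancel₀ (mul_ne_zero h3 h4) ?_
  rw [one_mul, mul_assoc, mul_left_comm]
  rw [h1] at h2
  linear_combination -h2

lemma weilPairing_ne_zero (hS : n • S = 0) (hT : n • T = 0) : weilPairing n S T ≠ 0 :=
  left_ne_zero_of_mul_eq_one (weilPairing_mul_swap hS hT)

lemma weilPairing_zero_right (hS : n • S = 0) : weilPairing n S 0 = 1 := by
  have h := weilPairing_add_right hS (smul_zero n) (smul_zero n)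
  rw [add_zero] at h
  exact (mul_eq_left₀ (weilPairing_ne_zero hS (smul_zero n))).mp h.symm

lemma weilPairing_nsmul_right (hS : n • S = 0) (hT : n • T = 0) (i : ℕ) :
    weilPairing n S (i • T) = weilPairing n S T ^ i := by
  induction i with
  | zero => rw [zero_smul, pow_zero, weilPairing_zero_right hS]
  | succ i ih =>
    rw [succ_nsmul, weilPairing_add_right hS (by rw [smul_comm, hT, smul_zero]) hT, ih, pow_succ]

lemma weilPairing_pow (hS : n • S = 0) (hT : n • T = 0) : weilPairing n S T ^ n = 1 := by
  rw [← weilPairing_nsmul_right hS hT, hT, weilPairing_zero_right hS]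

lemma weilPairing_neg_right (hS : n • S = 0) (hT : n • T = 0) :
    weilPairing n S (-T) = (weilPairing n S T)⁻¹ := by
  refine eq_inv_of_mul_eq_one_left ?_
  rw [← weilPairing_add_right hS (by rw [smul_neg, hT, neg_zero]) hT, neg_add_cancel,
    weilPairing_zero_right hS]

lemma weilPairing_swap (hS : n • S = 0) (hT : n • T = 0) :
    weilPairing n T S = (weilPairing n S T)⁻¹ :=
  eq_inv_of_mul_eq_one_left (weilPairing_mul_swap hT hS)

lemma weilPairing_neg_neg (hS : n • S = 0) (hT : n • T = 0) :
    weilPairing n (-S) (-T) = weilPairing n S T := by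
  have hS' : n • -S = 0 := by rw [smul_neg, hS, neg_zero]
  rw [weilPairing_neg_right hS' hT, weilPairing_swap hT hS', inv_inv,
    weilPairing_neg_right hT hS, weilPairing_swap hT hS]

end

end WeierstrassCurve.Affine

end

/-! ### Nondegeneracy of the pairing and the bound on `p`-torsion. -/

section

open Polynomial Filter

namespace WeierstrassCurve.Affine

open CoordinateRing

section Nondegenerate

variable {k : Type*} [Field k] {W : Affine k} [DecidableEq k]

lemma dvd_of_zsmul_add_zsmul_eq_zero {A : Type*} [AddCommGroup A] {p : ℕ} (hp : p.Prime)
    {S T : A} (hS : p • S = 0) (hT : p • T = 0) (hS0 : S ≠ 0)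
    (hST : T ∉ AddSubgroup.zmultiples S) {a b : ℤ} (h : a • S + b • T = 0) :
    (p : ℤ) ∣ a ∧ (p : ℤ) ∣ b := by
  have hS' : (p : ℤ) • S = 0 := by rw [natCast_zsmul, hS]
  have hT' : (p : ℤ) • T = 0 := by rw [natCast_zsmul, hT]
  have hprime := Nat.prime_iff_prime_int.mp hp
  have hb : (p : ℤ) ∣ b := by
    by_contra hb
    obtain ⟨u, v, huv⟩ := (hprime.coprime_iff_not_dvd).mpr hb
    refine hST (AddSubgroup.mem_zmultiples_iff.mpr ⟨-(v * a), ?_⟩)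
    have h1 : b • T = -(a • S) := eq_neg_of_add_eq_zero_right h
    calc (-(v * a)) • S = v • -(a • S) := by rw [neg_smul, mul_smul, smul_neg]
      _ = (u * p + v * b) • T := by
        rw [← h1, add_smul, mul_smul, mul_smul, hT', smul_zero, zero_add]
      _ = T := by rw [huv, one_smul]
  refine ⟨?_, hb⟩
  by_contra ha
  obtain ⟨c, rfl⟩ := hb
  rw [mul_comm, mul_smul, hT', smul_zero, add_zero] at h
  obtain ⟨u, v, huv⟩ := (hprime.coprime_iff_not_dvd).mpr ha
  refine hS0 ?_
  rw [← one_smul ℤ S, ← huv, add_smul, mul_smul, mul_smul, hS', h, smul_zero, smul_zero, add_zero]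

lemma injOn_nsmul_add_nsmul {A : Type*} [AddCommGroup A] {p : ℕ} (hp : p.Prime)
    {S T : A} (hS : p • S = 0) (hT : p • T = 0) (hS0 : S ≠ 0)
    (hST : T ∉ AddSubgroup.zmultiples S) : Set.InjOn (fun i : ℕ × ℕ => i.1 • S + i.2 • T)
      (Finset.range p ×ˢ Finset.range p : Finset (ℕ × ℕ)) := by
  rintro ⟨i, j⟩ hij ⟨i', j'⟩ hij' heq
  rw [Finset.mem_coe, Finset.mem_product, Finset.mem_range, Finset.mem_range] at hij hij'
  have h0 : ((i : ℤ) - i') • S + ((j : ℤ) - j') • T = 0 := by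
    rw [sub_smul, sub_smul, natCast_zsmul, natCast_zsmul, natCast_zsmul, natCast_zsmul,
      sub_add_sub_comm]
    exact sub_eq_zero.mpr heq
  obtain ⟨h1, h2⟩ := dvd_of_zsmul_add_zsmul_eq_zero hp hS hT hS0 hST h0
  have h3 := Int.eq_zero_of_abs_lt_dvd h1 (by rw [abs_lt]; lia)
  have h4 := Int.eq_zero_of_abs_lt_dvd h2 (by rw [abs_lt]; lia)
  ext <;> simp only <;> lia

variable [IsAlgClosed k] [W.IsElliptic] {n : ℕ}

/-- The translates of `h` by `R`, multiplied by a theta function, are proportional to `h`. -/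
def IsThetaEigen (n : ℕ) (h : W.CoordinateRing) (R : W.Point) : Prop :=
  ∃ f : W.Point → k, IsTheta n R f ∧ ∃ c : k, c ≠ 0 ∧
    ∀ᶠ X in cofinite, f X * (X - R).eval h = c * X.eval h

omit [IsAlgClosed k] [W.IsElliptic] in
lemma IsThetaEigen.zero (h : W.CoordinateRing) : IsThetaEigen n h 0 :=
  ⟨_, IsTheta.zero_one n, 1, one_ne_zero, Eventually.of_forall fun X => by rw [sub_zero]⟩

omit [IsAlgClosed k] [W.IsElliptic] in
lemma IsThetaEigen.add {h : W.CoordinateRing} {R S : W.Point} (hR : IsThetaEigen n h R)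
    (hS : IsThetaEigen n h S) : IsThetaEigen n h (R + S) := by
  obtain ⟨f, hf, c, hc, hfc⟩ := hR
  obtain ⟨g, hg, d, hd, hgd⟩ := hS
  refine ⟨_, hf.add hg, d * c, mul_ne_zero hd hc, ?_⟩
  filter_upwards [hfc, (tendsto_sub_cofinite R).eventually hgd] with X h1 h2
  rw [← sub_sub]
  linear_combination f X * h2 + d * h1

omit [IsAlgClosed k] [W.IsElliptic] in
lemma IsThetaEigen.nsmul {h : W.CoordinateRing} {R : W.Point} (hR : IsThetaEigen n h R) (i : ℕ) :
    IsThetaEigen n h (i • R) := by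
  induction i with
  | zero => rw [zero_smul]; exact .zero h
  | succ i ih => rw [succ_nsmul]; exact ih.add hR

/-- The eigenvector relation holds only at almost all points. Replacing `f` by the regular
multiplier `g` makes it an identity of regular functions, valid outside `0` and `±R`. -/
lemma IsThetaEigen.eval_eq_zero {h : W.CoordinateRing} (hh : h ∈ poleLE W n) {R : W.Point}
    (hR : IsThetaEigen n h R) (hn : n • R = 0) {X : W.Point} (h0 : X ≠ 0) (h1 : X ≠ R)
    (h2 : X ≠ -R) (hX : (X - R).eval h = 0) : X.eval h = 0 := by
  obtain ⟨f, hf, c, hc, hfc⟩ := hR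
  obtain ⟨g, -, hg, hgq⟩ := exists_isTheta hn
  obtain ⟨q, -, hq⟩ := hgq h hh
  obtain ⟨d, hd, hgf⟩ := hg.exists_eq_mul hf
  have hqh : q = (d * c) • h := by
    refine eq_of_eventually_eval_eq ?_
    filter_upwards [hfc, hgf, eventually_ne 0, eventually_ne R, eventually_ne (-R)]
      with Y h1 h2 h3 h4 h5
    rw [← (hq Y h3 h4 h5).2, h2, map_smul, smul_eq_mul]
    linear_combination d * h1
  have := (hq X h0 h1 h2).2
  rw [hX, mul_zero, hqh, map_smul, smul_eq_mul] at this
  exact (mul_eq_zero.mp this.symm).resolve_left (mul_ne_zero hd hc)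

/-- If `h` were constant, the multiplier `g` of `R` would be constant as well, but its pole has
order `n`. -/
lemma IsThetaEigen.poleOrder_pos {h : W.CoordinateRing} (hh0 : h ≠ 0) {R : W.Point}
    (hR : IsThetaEigen n h R) (hn : n • R = 0) (hR0 : R ≠ 0) (hn0 : n ≠ 0) : 0 < poleOrder h := by
  by_contra hpos
  obtain ⟨f, hf, c, hc, hfc⟩ := hR
  obtain ⟨g, hgn, hg, -⟩ := exists_isTheta hn
  obtain ⟨d, hd, hgf⟩ := hg.exists_eq_mul hf
  obtain ⟨a, rfl⟩ : ∃ a : k, h = a • 1 := by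
    obtain ⟨p, q, rfl⟩ := exists_smul_basis_eq h
    rw [not_lt, poleOrder_smul_basis_le_iff] at hpos
    rcases hpos.2 with rfl | hq
    · obtain ⟨a, rfl⟩ := natDegree_eq_zero.mp (by lia : p.natDegree = 0)
      refine ⟨a, ?_⟩
      rw [zero_smul, add_zero, smul_eq_algebraMap_C_mul, Algebra.smul_def]
    · lia
  have ha : a ≠ 0 := by
    rintro rfl
    exact hh0 (zero_smul k _)
  have hgc : g = (d * c) • (1 : W.CoordinateRing) := by
    refine eq_of_eventually_eval_eq ?_
    filter_upwards [hfc, hgf, eventually_ne 0, eventually_ne R] with Y h1 h2 h3 h4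
    rw [map_smul, map_smul, Point.eval_one h3, Point.eval_one (sub_ne_zero.mpr h4), smul_eq_mul,
      mul_one] at h1
    rw [h2, map_smul, Point.eval_one h3, smul_eq_mul, mul_one, mul_right_cancel₀ ha h1]
  have h0 : g ∈ poleLE W 0 := hgc ▸ Submodule.smul_mem _ _ (one_mem_poleLE 0)
  rw [mem_poleLE, hgn hR0] at h0
  lia

/-- A trivial pairing makes the two operators commute, so the second one has an eigenvector inside
an eigenspace of the first. Injectivity makes the eigenvalues nonzero. -/
lemma exists_isThetaEigen {S T : W.Point} (hS : n • S = 0) (hT : n • T = 0)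
    (h : weilPairing n S T = 1) : ∃ h ∈ poleLE W n, h ≠ 0 ∧
      IsThetaEigen n h S ∧ IsThetaEigen n h T := by
  obtain ⟨f, -, hf, -⟩ := exists_isTheta hS
  obtain ⟨g, -, hg, -⟩ := exists_isTheta hT
  have hcomm : Commute hf.op hg.op := by
    refine LinearMap.ext fun v => Subtype.ext (eq_of_eventually_eval_eq ?_)
    filter_upwards [weilPairing_spec hS hT hf hg, hf.op_spec (hg.op v), hg.op_spec (hf.op v),
      (tendsto_sub_cofinite S).eventually (hg.op_spec v),
      (tendsto_sub_cofinite T).eventually (hf.op_spec v)] with X h1 h2 h3 h4 h5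
    rw [Module.End.mul_apply, Module.End.mul_apply, ← h2, ← h3, ← h4, ← h5, sub_right_comm X T S]
    rw [h] at h1
    linear_combination (X - S - T).eval (v : W.CoordinateRing) * h1
  obtain ⟨c, hc⟩ := Module.End.exists_eigenvalue hf.op
  have hmaps : Set.MapsTo hg.op (Module.End.eigenspace hf.op c) (Module.End.eigenspace hf.op c) :=
    Module.End.mapsTo_genEigenspace_of_comm hcomm c 1
  have : Nontrivial (Module.End.eigenspace hf.op c) := Submodule.nontrivial_iff_ne_bot.mpr hc
  obtain ⟨d, hd⟩ := Module.End.exists_eigenvalue (K := k)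
    (V := Module.End.eigenspace hf.op c) (hg.op.restrict hmaps)
  obtain ⟨v, hv⟩ := hd.exists_hasEigenvector
  have hv1 : hf.op (v : poleLE W n) = c • (v : poleLE W n) := Module.End.mem_eigenspace_iff.mp v.2
  have hv2 : hg.op (v : poleLE W n) = d • (v : poleLE W n) := congrArg Subtype.val hv.apply_eq_smul
  have hv0 : (v : poleLE W n) ≠ 0 := fun h0 => hv.2 (Subtype.ext h0)
  have key {R : W.Point} {f : W.Point → k} (hf : IsTheta n R f) {c : k}
      (hc : hf.op (v : poleLE W n) = c • (v : poleLE W n)) :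
      IsThetaEigen n ((v : poleLE W n) : W.CoordinateRing) R := by
    refine ⟨f, hf, c, ?_, ?_⟩
    · rintro rfl
      rw [zero_smul] at hc
      exact hv0 (hf.op_injective (hc.trans (map_zero _).symm))
    · filter_upwards [hf.op_spec (v : poleLE W n)] with X hX
      rw [hX, hc, Submodule.coe_smul, map_smul, smul_eq_mul]
  exact ⟨_, (v : poleLE W n).2, fun h0 => hv0 (Subtype.ext h0), key hf hv1, key hg hv2⟩

/-- The Weil pairing of two independent `p`-torsion points is nontrivial. -/
theorem weilPairing_ne_one {p : ℕ} (hp : p.Prime) (hodd : Odd p) {S T : W.Point}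
    (hS : p • S = 0) (hT : p • T = 0) (hS0 : S ≠ 0) (hST : T ∉ AddSubgroup.zmultiples S) :
    weilPairing p S T ≠ 1 := by
  intro he
  obtain ⟨h, hh, hh0, hhS, hhT⟩ := exists_isThetaEigen hS hT he
  obtain ⟨X₀, hX0, hXh⟩ := exists_zero (hhS.poleOrder_pos hh0 hS hS0 hp.ne_zero)
  let φ : ℕ × ℕ → W.Point := fun i => i.1 • S + i.2 • T
  have hφ : Set.InjOn φ (Finset.range p ×ˢ Finset.range p : Finset (ℕ × ℕ)) :=
    injOn_nsmul_add_nsmul hp hS hT hS0 hST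
  have hφp (i : ℕ × ℕ) : p • φ i = 0 := by
    simp only [φ]
    rw [smul_add, smul_comm, hS, smul_comm p i.2, hT, smul_zero, smul_zero, add_zero]
  let M := (Finset.range p ×ˢ Finset.range p).image φ
  have hM : M.card = p * p := by
    rw [Finset.card_image_of_injOn hφ, Finset.card_product, Finset.card_range]
  have hMp : ∀ R ∈ M, p • R = 0 ∧ IsThetaEigen p h R := by
    intro R hR
    obtain ⟨i, -, rfl⟩ := Finset.mem_image.mp hR
    exact ⟨hφp i, (hhS.nsmul i.1).add (hhT.nsmul i.2)⟩
  -- For `R` in `B` the point `X₀ + R` equals `-R`, where vanishing does not propagate. Two such `R`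
  -- differ by a point killed by both 2 and the odd `p`, so there is at most one.
  let B := M.filter fun R => X₀ + R + R = 0
  have hB : B.card ≤ 1 := by
    refine Finset.card_le_one.mpr fun R hR R' hR' => ?_
    obtain ⟨hR1, hR2⟩ := Finset.mem_filter.mp hR
    obtain ⟨hR1', hR2'⟩ := Finset.mem_filter.mp hR'
    have h2 : 2 • (R - R') = 0 := by
      rw [two_nsmul, sub_add_sub_comm, sub_eq_zero]
      rw [add_assoc] at hR2 hR2'
      exact add_left_cancel (hR2.trans hR2'.symm)
    have hpR : p • (R - R') = 0 := by rw [smul_sub, (hMp R hR1).1, (hMp R' hR1').1, sub_zero]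
    obtain ⟨m, rfl⟩ := hodd
    rw [add_smul, mul_comm, mul_smul, h2, smul_zero, zero_add, one_smul] at hpR
    exact sub_eq_zero.mp hpR
  let G := (M \ {-X₀}) \ B
  have hG : p * p ≤ G.card + 2 := by
    have h1 := Finset.le_card_sdiff {-X₀} M
    have h2 := Finset.le_card_sdiff B (M \ {-X₀})
    rw [Finset.card_singleton] at h1
    change B.card ≤ 1 at hB
    change _ ≤ G.card at h2
    lia
  have hzeros := card_zeros_le hh0 (G.image (X₀ + ·)) fun P hP => by
    obtain ⟨R, hR, rfl⟩ := Finset.mem_image.mp hP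
    obtain ⟨hR1, hR2⟩ := Finset.mem_sdiff.mp hR
    obtain ⟨hR1, hR3⟩ := Finset.mem_sdiff.mp hR1
    have h0 : X₀ + R ≠ 0 := fun h0 =>
      hR3 (Finset.mem_singleton.mpr (eq_neg_of_add_eq_zero_right h0))
    refine ⟨h0, (hMp R hR1).2.eval_eq_zero hh (hMp R hR1).1 h0 ?_ ?_ ?_⟩
    · exact fun h1 => hX0 (add_eq_right.mp h1)
    · exact fun h1 => hR2 (Finset.mem_filter.mpr ⟨hR1, add_eq_zero_iff_eq_neg.mpr h1⟩)
    · rw [add_sub_cancel_right, hXh]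
  rw [Finset.card_image_of_injective _ (add_right_injective X₀)] at hzeros
  have h3 : 3 ≤ p := by
    have := hp.two_le
    rcases hodd with ⟨m, rfl⟩
    lia
  have hle : G.card ≤ 2 * p := hzeros.trans (Nat.mul_le_mul_left 2 hh)
  -- The two bounds give `p ^ 2 ≤ 2 * p + 2`, false for `p ≥ 3`.
  nlinarith

lemma mem_zmultiples_of_weilPairing_eq_one {p : ℕ} (hp : p.Prime) (hodd : Odd p) {S T : W.Point}
    (hS : p • S = 0) (hT : p • T = 0) (hS0 : S ≠ 0) (h : weilPairing p S T = 1) :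
    T ∈ AddSubgroup.zmultiples S := by
  by_contra hST
  exact weilPairing_ne_one hp hodd hS hT hS0 hST h

/-- An elliptic curve has at most `p ^ 2` points of order dividing an odd prime `p`. -/
theorem card_torsion_le {p : ℕ} (hp : p.Prime) (hodd : Odd p) (s : Finset W.Point)
    (hs : ∀ R ∈ s, p • R = 0) : s.card ≤ p ^ 2 := by
  by_cases h0 : ∃ S ∈ s, S ≠ 0
  · obtain ⟨S, hSs, hS0⟩ := h0
    have hS := hs S hSs
    -- Pairing with `S` takes values among the at most `p` roots of unity, and each fibre lies in a
    -- coset of the multiples of `S` by nondegeneracy.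
    have himage : (s.image (weilPairing p S)).card ≤ p := by
      refine (Finset.card_le_card (t := (nthRoots p (1 : k)).toFinset) fun ζ hζ => ?_).trans
        ((Multiset.toFinset_card_le _).trans (card_nthRoots p 1))
      obtain ⟨T, hT, rfl⟩ := Finset.mem_image.mp hζ
      exact Multiset.mem_toFinset.mpr ((mem_nthRoots hp.pos).mpr (weilPairing_pow hS (hs T hT)))
    refine (Finset.card_le_mul_card_image s p fun ζ hζ => ?_).trans
      ((Nat.mul_le_mul_left p himage).trans_eq (sq p).symm)
    obtain ⟨T, hT, rfl⟩ := Finset.mem_image.mp hζ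
    refine (Finset.card_le_card (t := (Finset.range p).image fun i => T + i • S)
      fun R hR => ?_).trans (Finset.card_image_le.trans_eq (Finset.card_range p))
    obtain ⟨hRs, hRT⟩ := Finset.mem_filter.mp hR
    have hT' : p • -T = 0 := by rw [smul_neg, hs T hT, neg_zero]
    have hRT' : weilPairing p S (R + -T) = 1 := by
      rw [weilPairing_add_right hS (hs R hRs) hT', weilPairing_neg_right hS (hs T hT), hRT,
        mul_inv_cancel₀ (weilPairing_ne_zero hS (hs T hT))]
    obtain ⟨a, ha⟩ := mem_zmultiples_of_weilPairing_eq_one hp hodd hS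
      (by rw [smul_add, hs R hRs, hT', add_zero]) hS0 hRT'
    have hp0 : (0 : ℤ) < p := mod_cast hp.pos
    refine Finset.mem_image.mpr ⟨(a % p).toNat, Finset.mem_range.mpr ?_, ?_⟩
    · have := Int.emod_lt_of_pos a hp0
      have := Int.emod_nonneg a hp0.ne'
      lia
    · have h1 : ((a % p).toNat : ℤ) = a % p := Int.toNat_of_nonneg (Int.emod_nonneg a hp0.ne')
      have h2 : (a % p) • S = a • S := by
        conv_rhs => rw [← Int.emod_add_mul_ediv a p]
        rw [add_smul, mul_comm, mul_smul, natCast_zsmul, hS, smul_zero, add_zero]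
      rw [← natCast_zsmul, h1, h2, show a • S = R + -T from ha]
      abel
  · push Not at h0
    have hs1 : s ⊆ {0} := fun R hR => Finset.mem_singleton.mpr (h0 R hR)
    exact (Finset.card_le_card hs1).trans
      ((Finset.card_singleton _).trans_le (Nat.one_le_pow _ _ hp.pos))

end Nondegenerate

/-! ### Galois equivariance of the pairing. -/

section Galois

variable {K k : Type*} [Field K] [Field k] [Algebra K k] {E : Affine K}

/-- Apply `σ` to the coefficients of `h` in the basis `1, Y`; the equation of the curve is unchanged
since it is defined over `K`. -/
lemma exists_conjugate (σ : k →ₐ[K] k) {n : ℕ} {h : (E⁄k).toAffine.CoordinateRing}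
    (hh : h ∈ poleLE (E⁄k).toAffine n) [DecidableEq k] :
    ∃ h' ∈ poleLE (E⁄k).toAffine n,
      ∀ X : (E⁄k).toAffine.Point, (Point.map (W' := E) σ X).eval h' = σ (X.eval h) := by
  obtain ⟨p, q, rfl⟩ := exists_smul_basis_eq h
  rw [mem_poleLE, poleOrder_smul_basis_le_iff] at hh
  have hev (x : k) (r : k[X]) : (r.map (σ : k →+* k)).eval (σ x) = σ (r.eval x) := by
    exact eval_map_apply (σ : k →+* k) x
  refine ⟨p.map (σ : k →+* k) • 1 + q.map (σ : k →+* k) • CoordinateRing.mk (E⁄k).toAffine X,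
    (poleOrder_smul_basis_le_iff _ _ _).mpr ?_, fun P => ?_⟩
  · rw [natDegree_map, natDegree_map, Polynomial.map_eq_zero]
    exact hh
  · match P with
    | 0 => exact (map_zero σ).symm
    | .some x y hxy =>
      rw [Point.map_some, Point.eval_some, Point.eval_some, map_add, map_add, map_add, evalAt_smul,
        evalAt_smul, evalAt_smul, evalAt_smul, evalAt_mk_Y, evalAt_mk_Y, map_one, map_one, hev, hev,
        map_mul, map_mul, map_one]

variable [DecidableEq k] (σ : k ≃ₐ[K] k)

lemma Point.map_equiv_symm (X : (E⁄k).toAffine.Point) :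
    Point.map (W' := E) (σ : k →ₐ[K] k) (Point.map (W' := E) (σ.symm : k →ₐ[K] k) X) = X := by
  rw [Point.map_map, AlgEquiv.comp_symm]
  cases X <;> rfl

lemma IsTheta.map {n : ℕ} {R : (E⁄k).toAffine.Point} {f : (E⁄k).toAffine.Point → k}
    (hf : IsTheta n R f) : IsTheta n (Point.map (W' := E) (σ : k →ₐ[K] k) R)
      (fun X => σ (f (Point.map (W' := E) (σ.symm : k →ₐ[K] k) X))) := by
  have htends : Tendsto (Point.map (W' := E) (σ.symm : k →ₐ[K] k)) cofinite cofinite :=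
    (Point.map_injective (W' := E) (σ.symm : k →ₐ[K] k)).tendsto_cofinite
  refine ⟨?_, fun h hh => ?_⟩
  · filter_upwards [htends.eventually hf.1] with X hX
    exact (map_ne_zero σ).mpr hX
  · obtain ⟨h', hh', hhX⟩ := exists_conjugate (σ.symm : k →ₐ[K] k) hh
    obtain ⟨q', hq', hqX⟩ := hf.2 h' hh'
    obtain ⟨q, hq, hqX'⟩ := exists_conjugate (σ : k →ₐ[K] k) hq'
    refine ⟨q, hq, ?_⟩
    filter_upwards [htends.eventually hqX] with X hX
    have h1 := hqX' (Point.map (W' := E) (σ.symm : k →ₐ[K] k) X)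
    rw [Point.map_equiv_symm, ← hX] at h1
    rw [h1]
    have h2 := hhX (X - Point.map (W' := E) (σ : k →ₐ[K] k) R)
    have h3 : Point.map (W' := E) (σ.symm : k →ₐ[K] k) (Point.map (W' := E) (σ : k →ₐ[K] k) R) = R :=
      Point.map_equiv_symm σ.symm R
    rw [map_sub, h3] at h2
    rw [h2]
    simp

variable [IsAlgClosed k] [(E⁄k).IsElliptic]

/-- The Weil pairing commutes with automorphisms. -/
lemma weilPairing_map {n : ℕ} {S T : (E⁄k).toAffine.Point} (hS : n • S = 0) (hT : n • T = 0) :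
    weilPairing n (Point.map (W' := E) (σ : k →ₐ[K] k) S)
      (Point.map (W' := E) (σ : k →ₐ[K] k) T) = σ (weilPairing n S T) := by
  obtain ⟨f, -, hf, -⟩ := exists_isTheta hS
  obtain ⟨g, -, hg, -⟩ := exists_isTheta hT
  have htends : Tendsto (Point.map (W' := E) (σ.symm : k →ₐ[K] k)) cofinite cofinite :=
    (Point.map_injective (W' := E) (σ.symm : k →ₐ[K] k)).tendsto_cofinite
  have hsymm (R : (E⁄k).toAffine.Point) :
      Point.map (W' := E) (σ.symm : k →ₐ[K] k) (Point.map (W' := E) (σ : k →ₐ[K] k) R) = R :=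
    Point.map_equiv_symm σ.symm R
  refine weilPairing_eq (by rw [← map_nsmul, hS, map_zero]) (by rw [← map_nsmul, hT, map_zero])
    (hf.map σ) (hg.map σ) ?_
  filter_upwards [htends.eventually (weilPairing_spec hS hT hf hg)] with X hX
  rw [map_sub, map_sub, hsymm, hsymm, ← map_mul, ← map_mul, ← map_mul, hX]

end Galois

end WeierstrassCurve.Affine

end

/-! ### Two-torsion of quadratic twists. -/

section

open Polynomial

namespace WeierstrassCurve.Affine

section Twist

variable {F : Type*} [Field F] [DecidableEq F] [NeZero (2 : F)] {W : Affine F}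

omit [NeZero (2 : F)] in
lemma Point.two_nsmul_some_eq_zero_iff {x y : F} (h : W.Nonsingular x y) :
    2 • Point.some x y h = 0 ↔ 2 * y = -(W.a₁ * x + W.a₃) := by
  rw [two_nsmul, add_eq_zero_iff_eq_neg, Point.neg_some, Point.some.injEq, negY]
  constructor
  · rintro ⟨-, hy⟩
    linear_combination hy
  · exact fun hy => ⟨rfl, by linear_combination hy⟩

omit [DecidableEq F] in
/-- Over a field of characteristic different from `2`, the `X`-coordinates of the points of
order `2` are the roots of `4 X ^ 3 + b₂ X ^ 2 + 2 b₄ X + b₆`. -/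
lemma equation_half_iff (x : F) : W.Equation x (-(W.a₁ * x + W.a₃) / 2) ↔
    4 * x ^ 3 + W.b₂ * x ^ 2 + 2 * W.b₄ * x + W.b₆ = 0 := by
  have h2 : (2 : F) ≠ 0 := two_ne_zero
  rw [equation_iff', b₂, b₄, b₆]
  field_simp
  constructor <;> intro h <;> linear_combination -h

variable {W' : Affine F} [W'.IsElliptic] {d : F}

/-- The map between the `2`-torsion subgroups of a curve and of its quadratic twist that
multiplies the `X`-coordinate by `d`. -/
noncomputable def twistTwoTorsion (h₂ : W'.b₂ = d * W.b₂)
    (h₄ : W'.b₄ = d ^ 2 * W.b₄) (h₆ : W'.b₆ = d ^ 3 * W.b₆) :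
    {P : W.Point // 2 • P = 0} → {P : W'.Point // 2 • P = 0}
  | ⟨0, _⟩ => ⟨0, smul_zero 2⟩
  | ⟨.some x y h, hP⟩ => ⟨.some (d * x) (-(W'.a₁ * (d * x) + W'.a₃) / 2) <|
      equation_iff_nonsingular.mp <| (equation_half_iff (d * x)).mpr <| by
        have hy : y = -(W.a₁ * x + W.a₃) / 2 := by
          rw [eq_div_iff two_ne_zero, mul_comm]
          exact (Point.two_nsmul_some_eq_zero_iff h).mp hP
        have hx := (equation_half_iff x).mp (hy ▸ h.1)
        rw [h₂, h₄, h₆]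
        linear_combination d ^ 3 * hx,
    (Point.two_nsmul_some_eq_zero_iff _).mpr (mul_div_cancel₀ _ two_ne_zero)⟩

omit [NeZero (2 : F)] in
/-- Points of order dividing `2` with the same `X`-coordinate are equal. -/
lemma Point.eq_of_X_eq_of_two_nsmul_eq_zero {x y x' y' : F} {h : W.Nonsingular x y}
    {h' : W.Nonsingular x' y'} (hP : 2 • Point.some x y h = 0) (hx : x = x') :
    Point.some x y h = Point.some x' y' h' := by
  rw [two_nsmul, add_eq_zero_iff_eq_neg] at hP
  rcases Point.X_eq_iff.mp hx with h1 | h1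
  · exact h1
  · rw [hP, h1, neg_neg]

lemma twistTwoTorsion_add (hd : d ≠ 0) (h₂ : W'.b₂ = d * W.b₂) (h₄ : W'.b₄ = d ^ 2 * W.b₄)
    (h₆ : W'.b₆ = d ^ 3 * W.b₆) (P Q R : {P : W.Point // 2 • P = 0})
    (hR : (R : W.Point) = P + Q) :
    (twistTwoTorsion h₂ h₄ h₆ R : W'.Point) =
      twistTwoTorsion h₂ h₄ h₆ P + twistTwoTorsion h₂ h₄ h₆ Q := by
  match P, Q, hR with
  | ⟨0, _⟩, Q, hR =>
    obtain rfl : R = Q := Subtype.ext (hR.trans (zero_add _))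
    exact (zero_add _).symm
  | P, ⟨0, _⟩, hR =>
    obtain rfl : R = P := Subtype.ext (hR.trans (add_zero _))
    exact (add_zero _).symm
  | ⟨.some x y h, hP⟩, ⟨.some x' y' h', hQ⟩, hR =>
    by_cases hx : x = x'
    · have hPQ := Point.eq_of_X_eq_of_two_nsmul_eq_zero (h' := h') hP hx
      have h0 : R = ⟨0, smul_zero 2⟩ := Subtype.ext (hR.trans (by
        change Point.some x y h + Point.some x' y' h' = 0
        rw [hPQ, ← two_nsmul]
        exact hQ))
      have hPQ' : (⟨.some x y h, hP⟩ : {P : W.Point // 2 • P = 0}) = ⟨.some x' y' h', hQ⟩ :=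
        Subtype.ext hPQ
      rw [h0, hPQ', ← two_nsmul]
      exact (twistTwoTorsion h₂ h₄ h₆ _).2.symm
    · have hR' := hR.trans (Point.add_of_X_ne hx)
      obtain ⟨R, hR2⟩ := R
      subst hR'
      have hdx : d * x ≠ d * x' := fun h => hx (mul_left_cancel₀ hd h)
      have h2 : (2 : F) ≠ 0 := two_ne_zero
      have hxx : x - x' ≠ 0 := sub_ne_zero.mpr hx
      have hy := (Point.two_nsmul_some_eq_zero_iff h).mp hP
      have hy' := (Point.two_nsmul_some_eq_zero_iff h').mp hQ
      obtain rfl : y = -(W.a₁ * x + W.a₃) / 2 := by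
        rw [eq_div_iff h2, mul_comm, hy]
      obtain rfl : y' = -(W.a₁ * x' + W.a₃) / 2 := by
        rw [eq_div_iff h2, mul_comm, hy']
      refine Eq.trans ?_ (Point.add_of_X_ne hdx).symm
      refine Point.eq_of_X_eq_of_two_nsmul_eq_zero (twistTwoTorsion h₂ h₄ h₆ ⟨_, hR2⟩).2 ?_
      -- All 2-torsion points lie on the line `2 * y + a₁ * x + a₃ = 0`. With its slope the abscissa
      -- of the sum is `-b₂ / 4 - x - x'`, which scales by `d`.
      have hs : W.slope x x' (-(W.a₁ * x + W.a₃) / 2) (-(W.a₁ * x' + W.a₃) / 2) = -W.a₁ / 2 := by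
        rw [slope_of_X_ne hx]
        field_simp
        ring
      have hs' : W'.slope (d * x) (d * x') (-(W'.a₁ * (d * x) + W'.a₃) / 2)
          (-(W'.a₁ * (d * x') + W'.a₃) / 2) = -W'.a₁ / 2 := by
        rw [slope_of_X_ne hdx, div_eq_iff (sub_ne_zero.mpr hdx)]
        ring
      rw [hs, hs', addX, addX]
      have h4 : (4 : F) ≠ 0 := by
        rw [show (4 : F) = 2 * 2 by norm_num]
        exact mul_ne_zero h2 h2
      rw [b₂, b₂] at h₂
      field_simp
      linear_combination h₂

variable [W.IsElliptic]

lemma twistTwoTorsion_twistTwoTorsion (hd : d ≠ 0) (h₂ : W'.b₂ = d * W.b₂)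
    (h₄ : W'.b₄ = d ^ 2 * W.b₄) (h₆ : W'.b₆ = d ^ 3 * W.b₆) (h₂' : W.b₂ = d⁻¹ * W'.b₂)
    (h₄' : W.b₄ = d⁻¹ ^ 2 * W'.b₄) (h₆' : W.b₆ = d⁻¹ ^ 3 * W'.b₆)
    (P : {P : W.Point // 2 • P = 0}) :
    twistTwoTorsion h₂' h₄' h₆' (twistTwoTorsion h₂ h₄ h₆ P) = P := by
  match P with
  | ⟨0, _⟩ => rfl
  | ⟨.some x y h, hP⟩ =>
    exact Subtype.ext (Point.eq_of_X_eq_of_two_nsmul_eq_zero hP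
      (inv_mul_cancel_left₀ hd x).symm).symm

/-- The `2`-torsion subgroups of a curve and of its quadratic twist are isomorphic. -/
theorem nonempty_twoTorsion_addEquiv (hd : d ≠ 0) (h₂ : W'.b₂ = d * W.b₂)
    (h₄ : W'.b₄ = d ^ 2 * W.b₄) (h₆ : W'.b₆ = d ^ 3 * W.b₆) :
    Nonempty (AddSubgroup.torsionBy W'.Point 2 ≃+ AddSubgroup.torsionBy W.Point 2) := by
  have h₂' : W.b₂ = d⁻¹ * W'.b₂ := by rw [h₂]; field_simp
  have h₄' : W.b₄ = d⁻¹ ^ 2 * W'.b₄ := by rw [h₄]; field_simp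
  have h₆' : W.b₆ = d⁻¹ ^ 3 * W'.b₆ := by rw [h₆]; field_simp
  have hmem {V : Affine F} {P : V.Point} : P ∈ AddSubgroup.torsionBy V.Point 2 ↔ 2 • P = 0 := by
    rw [← natCast_zsmul]
    exact Submodule.mem_torsionBy_iff _ _
  have hd' : d⁻¹ ≠ 0 := inv_ne_zero hd
  exact ⟨{
    toFun := fun P => ⟨(twistTwoTorsion h₂' h₄' h₆' ⟨P.1, hmem.mp P.2⟩).1,
      hmem.mpr (twistTwoTorsion h₂' h₄' h₆' ⟨P.1, hmem.mp P.2⟩).2⟩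
    invFun := fun P => ⟨(twistTwoTorsion h₂ h₄ h₆ ⟨P.1, hmem.mp P.2⟩).1,
      hmem.mpr (twistTwoTorsion h₂ h₄ h₆ ⟨P.1, hmem.mp P.2⟩).2⟩
    left_inv := fun P => Subtype.ext <| by
      have := twistTwoTorsion_twistTwoTorsion hd' h₂' h₄' h₆' (by rwa [inv_inv])
        (by rwa [inv_inv]) (by rwa [inv_inv]) ⟨P.1, hmem.mp P.2⟩
      simp only [inv_inv] at this
      exact congrArg Subtype.val this
    right_inv := fun P => Subtype.ext <|
      congrArg Subtype.val (twistTwoTorsion_twistTwoTorsion hd h₂ h₄ h₆ h₂' h₄' h₆'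
        ⟨P.1, hmem.mp P.2⟩)
    map_add' := fun P Q => Subtype.ext (twistTwoTorsion_add hd' h₂' h₄' h₆' _ _ _ rfl) }⟩

end Twist

end WeierstrassCurve.Affine

open WeierstrassCurve WeierstrassCurve.Affine

/-! ### Recognizing torsion subgroups as abstract groups. -/

section Group

lemma nonempty_addEquiv_zmod_one_iff {A : Type*} [AddCommGroup A] (n : ℕ) :
    Nonempty (AddSubgroup.torsionBy A n ≃+ ZMod 1) ↔ ∀ x : A, n • x = 0 → x = 0 := by
  constructor
  · rintro ⟨e⟩ x hx
    have hx' : x ∈ AddSubgroup.torsionBy A n :=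
      (Submodule.mem_torsionBy_iff _ _).mpr (by rw [natCast_zsmul, hx])
    exact congrArg Subtype.val (e.injective (Subsingleton.elim (e ⟨x, hx'⟩) (e 0)))
  · intro h
    have : Subsingleton (AddSubgroup.torsionBy A n) := ⟨fun x y => Subtype.ext <| by
      have hx := h x (by rw [← natCast_zsmul]; exact (Submodule.mem_torsionBy_iff _ _).mp x.2)
      have hy := h y (by rw [← natCast_zsmul]; exact (Submodule.mem_torsionBy_iff _ _).mp y.2)
      rw [hx, hy]⟩
    let : Unique (AddSubgroup.torsionBy A n) := ⟨⟨0⟩, fun x => Subsingleton.elim x 0⟩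
    exact ⟨AddEquiv.ofUnique⟩

lemma mem_torsionBy_natCast {A : Type*} [AddCommGroup A] {n : ℕ} {x : A} :
    x ∈ AddSubgroup.torsionBy A n ↔ n • x = 0 := by
  rw [← natCast_zsmul]
  exact Submodule.mem_torsionBy_iff _ _

lemma nonempty_addEquiv_zmod_prod_of_module {A : Type*} [AddCommGroup A] {p : ℕ}
    (hp : p.Prime) [Module (ZMod p) A] (hcard : Nat.card A = p ^ 2) :
    Nonempty (A ≃+ ZMod p × ZMod p) := by
  have : Fact p.Prime := ⟨hp⟩
  have : Finite A := Nat.finite_of_card_ne_zero (by rw [hcard]; exact pow_ne_zero 2 hp.ne_zero)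
  have h : Module.finrank (ZMod p) A = 2 := Nat.pow_right_injective hp.two_le
    ((FiniteField.pow_finrank_eq_natCard p A).trans hcard)
  exact ⟨((Module.finBasisOfFinrankEq (ZMod p) A h).equivFun.trans
    (LinearEquiv.finTwoArrow (ZMod p) (ZMod p))).toAddEquiv⟩

lemma nonempty_addEquiv_zmod_prod {A : Type*} [AddCommGroup A] {p : ℕ} (hp : p.Prime)
    (h : ∀ x : A, p • x = 0) (hcard : Nat.card A = p ^ 2) :
    Nonempty (A ≃+ ZMod p × ZMod p) :=
  @nonempty_addEquiv_zmod_prod_of_module A _ p hp (AddCommGroup.zmodModule h) hcard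

end Group

namespace WeierstrassCurve

/-! ### Galois descent of points in a quadratic extension. -/

section Quadratic

lemma exists_galois_involution (K L : Type*) [Field K] [CharZero K] [Field L] [Algebra K L]
    [Algebra.IsQuadraticExtension K L] : ∃ σ : L ≃ₐ[K] L, (∀ τ : L ≃ₐ[K] L, τ = 1 ∨ τ = σ) ∧
      σ * σ = 1 ∧ ∀ x, σ x = x → x ∈ Set.range (algebraMap K L) := by
  have : IsGalois K L := IsGalois.mk
  have hcard := IsGalois.card_aut_eq_finrank K L
  rw [Algebra.IsQuadraticExtension.finrank_eq_two] at hcard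
  obtain ⟨σ, hσ, huniq⟩ := (Nat.card_eq_two_iff' (1 : L ≃ₐ[K] L)).mp hcard
  have hall (τ : L ≃ₐ[K] L) : τ = 1 ∨ τ = σ := or_iff_not_imp_left.mpr (huniq τ)
  refine ⟨σ, hall, ?_, fun x hx => ?_⟩
  · exact (hall (σ * σ)).resolve_right fun h => hσ (mul_eq_left.mp h)
  · rw [IsGalois.mem_range_algebraMap_iff_fixed]
    intro τ
    rcases hall τ with rfl | rfl
    · rfl
    · exact hx

variable {K L : Type*} [Field K] [DecidableEq K] [Field L] [DecidableEq L] [Algebra K L]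
  {E : WeierstrassCurve K}

lemma exists_map_eq_of_fixed {σ : L ≃ₐ[K] L}
    (hσ : ∀ x, σ x = x → x ∈ Set.range (algebraMap K L)) {P : (E⁄L).toAffine.Point}
    (hP : Point.map (W' := E.toAffine) (σ : L →ₐ[K] L) P = P) :
    ∃ Q : (E⁄K).toAffine.Point, Point.map (W' := E.toAffine) (Algebra.ofId K L) Q = P := by
  match P with
  | 0 => exact ⟨0, map_zero _⟩
  | .some x y h =>
    rw [Point.map_some, Point.some.injEq] at hP
    obtain ⟨x, rfl⟩ := hσ x hP.1
    obtain ⟨y, rfl⟩ := hσ y hP.2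
    exact ⟨.some x y ((E.toAffine.baseChange_nonsingular (Algebra.ofId K L).injective ..).mp h),
      rfl⟩

lemma map_map_ofId (σ : L ≃ₐ[K] L) (Q : (E⁄K).toAffine.Point) :
    Point.map (W' := E.toAffine) (σ : L →ₐ[K] L)
      (Point.map (W' := E.toAffine) (Algebra.ofId K L) Q) =
        Point.map (W' := E.toAffine) (Algebra.ofId K L) Q := by
  match Q with
  | 0 => rfl
  | .some x y h =>
    have hx (x : K) : (σ : L →ₐ[K] L) (Algebra.ofId K L x) = Algebra.ofId K L x := σ.commutes x
    simp only [Point.map_some, hx]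

omit [DecidableEq K] in
lemma map_map_of_mul_self_eq_one {σ : L ≃ₐ[K] L} (hσ : σ * σ = 1) (P : (E⁄L).toAffine.Point) :
    Point.map (W' := E.toAffine) (σ : L →ₐ[K] L)
      (Point.map (W' := E.toAffine) (σ : L →ₐ[K] L) P) = P := by
  have h (x : L) : σ (σ x) = x := DFunLike.congr_fun hσ x
  match P with
  | 0 => rfl
  | .some x y hxy => simp only [Point.map_some, AlgEquiv.coe_toAlgHom, h]

end Quadratic

end WeierstrassCurve

end

/-! ### Involutions on primary torsion, and rationality of roots of unity. -/

section

open WeierstrassCurve WeierstrassCurve.Affine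

section Group

lemma exists_primitiveRoot_of_pow_eq_one {F : Type*} [Field F] {p : ℕ} (hp : p.Prime) {ζ : F}
    (h : ζ ^ p = 1) (h1 : ζ ≠ 1) : IsPrimitiveRoot ζ p :=
  have : Fact p.Prime := ⟨hp⟩
  IsPrimitiveRoot.iff_orderOf.mpr (orderOf_eq_prime h h1)

variable {A : Type*} [AddCommGroup A] {p : ℕ}

lemma exists_nsmul_ne_zero_of_pow_nsmul_eq_zero {x : A} (hx : x ≠ 0) {n : ℕ}
    (hn : p ^ n • x = 0) : ∃ j : ℕ, p ^ j • x ≠ 0 ∧ p • p ^ j • x = 0 := by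
  induction n with
  | zero => exact absurd (by simpa using hn) hx
  | succ n ih =>
    by_cases h : p ^ n • x = 0
    · exact ih h
    · exact ⟨n, h, by rw [← mul_smul, ← pow_succ', hn]⟩

lemma eq_zero_of_neg_eq_self (hodd : Odd p) {x : A} (hx : p • x = 0) (h : -x = x) : x = 0 := by
  obtain ⟨m, rfl⟩ := hodd
  have h2 : 2 • x = 0 := by
    rw [two_nsmul]
    nth_rewrite 1 [← h]
    exact neg_add_cancel x
  rwa [add_smul, mul_comm, mul_smul, h2, smul_zero, zero_add, one_smul] at hx

/-- If an involution `s` of an abelian group is the identity on `p`-torsion elements that it maps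
to their opposite, then it fixes all elements of `p`-power order. -/
lemma apply_eq_self_of_pow_nsmul_eq_zero (s : A →+ A) (hs : ∀ x, s (s x) = x)
    (h : ∀ x, p • x = 0 → s x = -x → x = 0) {x : A} {n : ℕ} (hn : p ^ n • x = 0) : s x = x := by
  by_contra hne
  have hne' : x - s x ≠ 0 := fun h0 => hne (sub_eq_zero.mp h0).symm
  obtain ⟨j, hj, hj'⟩ := exists_nsmul_ne_zero_of_pow_nsmul_eq_zero hne' (n := n)
    (by rw [smul_sub, ← map_nsmul, hn, map_zero, sub_zero])
  -- The element `x - s x` is negated by `s`, and so is its multiple of order `p`, against the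
  -- hypothesis.
  exact hj (h _ hj' (by rw [map_nsmul, map_sub, hs, ← smul_neg, neg_sub]))

end Group

namespace WeierstrassCurve

variable {K L : Type*} [Field K] [DecidableEq K] [Field L] [DecidableEq L] [Algebra K L]
  {E : WeierstrassCurve K} [E.IsElliptic] {p : ℕ}

instance : (E⁄L).IsElliptic := inferInstanceAs (E.map _).IsElliptic

omit [DecidableEq K] in
lemma card_torsion_le (hp : p.Prime) (hodd : Odd p) (s : Finset (E⁄L).toAffine.Point)
    (hs : ∀ R ∈ s, p • R = 0) : s.card ≤ p ^ 2 := by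
  classical
  let ι := Point.map (W' := E.toAffine) (IsScalarTower.toAlgHom K L (AlgebraicClosure L))
  rw [← Finset.card_image_of_injective s (Point.map_injective
    (W' := E.toAffine) (IsScalarTower.toAlgHom K L (AlgebraicClosure L)))]
  refine Affine.card_torsion_le hp hodd _ fun R hR => ?_
  obtain ⟨P, hP, rfl⟩ := Finset.mem_image.mp hR
  rw [← map_nsmul, hs P hP, map_zero]

omit [DecidableEq K] in
/-- Two independent `p`-torsion points over `L` determine a primitive `p`-th root of unity,
compatibly with the action of automorphisms. -/
lemma exists_primitiveRoot_galois [Normal K L] (hp : p.Prime) (hodd : Odd p)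
    {S T : (E⁄L).toAffine.Point} (hS : p • S = 0) (hT : p • T = 0) (hS0 : S ≠ 0)
    (hST : T ∉ AddSubgroup.zmultiples S) :
    ∃ ζ : AlgebraicClosure L, IsPrimitiveRoot ζ p ∧
      ∀ τ : AlgebraicClosure L ≃ₐ[K] AlgebraicClosure L,
        (Point.map (W' := E.toAffine) (τ.restrictNormal L : L →ₐ[K] L) S = S →
          Point.map (W' := E.toAffine) (τ.restrictNormal L : L →ₐ[K] L) T = T → τ ζ = ζ) ∧
        (Point.map (W' := E.toAffine) (τ.restrictNormal L : L →ₐ[K] L) S = -S →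
          Point.map (W' := E.toAffine) (τ.restrictNormal L : L →ₐ[K] L) T = -T → τ ζ = ζ) ∧
        (Point.map (W' := E.toAffine) (τ.restrictNormal L : L →ₐ[K] L) S = S →
          Point.map (W' := E.toAffine) (τ.restrictNormal L : L →ₐ[K] L) T = -T → τ ζ = ζ⁻¹) := by
  classical
  let ι : (E⁄L).toAffine.Point →+ (E⁄(AlgebraicClosure L)).toAffine.Point :=
    Point.map (W' := E.toAffine) (IsScalarTower.toAlgHom K L (AlgebraicClosure L))
  have hι : Function.Injective ι := Point.map_injective ..
  have hcomm (τ : AlgebraicClosure L ≃ₐ[K] AlgebraicClosure L) (P : (E⁄L).toAffine.Point) :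
      Point.map (W' := E.toAffine) (τ : AlgebraicClosure L →ₐ[K] AlgebraicClosure L) (ι P) =
        ι (Point.map (W' := E.toAffine) (τ.restrictNormal L : L →ₐ[K] L) P) := by
    have h : (τ : AlgebraicClosure L →ₐ[K] AlgebraicClosure L).comp
        (IsScalarTower.toAlgHom K L (AlgebraicClosure L)) =
        (IsScalarTower.toAlgHom K L (AlgebraicClosure L)).comp
          (τ.restrictNormal L : L →ₐ[K] L) :=
      AlgHom.ext fun x => (τ.restrictNormal_commutes L x).symm
    simp only [ι]
    rw [Point.map_map, Point.map_map, h]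
  have hS' : p • ι S = 0 := by rw [← map_nsmul, hS, map_zero]
  have hT' : p • ι T = 0 := by rw [← map_nsmul, hT, map_zero]
  have hST' : ι T ∉ AddSubgroup.zmultiples (ι S) := by
    rintro ⟨a, ha⟩
    refine hST ⟨a, hι ?_⟩
    rw [← ha]
    exact map_zsmul ι a S
  refine ⟨weilPairing p (ι S) (ι T), exists_primitiveRoot_of_pow_eq_one hp
    (weilPairing_pow hS' hT') (weilPairing_ne_one hp hodd hS' hT'
      (fun h => hS0 (hι (h.trans (map_zero ι).symm))) hST'), fun τ => ?_⟩
  have key := weilPairing_map (E := E.toAffine) τ hS' hT'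
  rw [hcomm, hcomm] at key
  refine ⟨fun h1 h2 => ?_, fun h1 h2 => ?_, fun h1 h2 => ?_⟩
  · rw [← key, h1, h2]
  · rw [← key, h1, h2, map_neg, map_neg, weilPairing_neg_neg hS' hT']
  · rw [← key, h1, h2, map_neg, weilPairing_neg_right hS' hT']

section Quadratic

variable [CharZero K] [Algebra.IsQuadraticExtension K L]

omit [DecidableEq K] in
/-- If the Galois group acts on two independent `p`-torsion points by signs, simultaneously, then
the `p`-th roots of unity are rational. -/
lemma exists_primitiveRoot_of_neg (hp : p.Prime) (hodd : Odd p) {σ : L ≃ₐ[K] L}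
    (hσ : ∀ τ : L ≃ₐ[K] L, τ = 1 ∨ τ = σ) {S T : (E⁄L).toAffine.Point} (hS : p • S = 0)
    (hT : p • T = 0) (hS0 : S ≠ 0) (hST : T ∉ AddSubgroup.zmultiples S)
    (hσS : Point.map (W' := E.toAffine) (σ : L →ₐ[K] L) S = -S)
    (hσT : Point.map (W' := E.toAffine) (σ : L →ₐ[K] L) T = -T) :
    ∃ ζ : K, IsPrimitiveRoot ζ p := by
  obtain ⟨ζ, hζ, hτ⟩ := exists_primitiveRoot_galois hp hodd hS hT hS0 hST
  have : Algebra.IsAlgebraic K (AlgebraicClosure L) := Algebra.IsAlgebraic.trans K L _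
  have : IsAlgClosure K (AlgebraicClosure L) := ⟨inferInstance, inferInstance⟩
  have : Normal K (AlgebraicClosure L) := IsAlgClosure.normal K _
  have : IsGalois K (AlgebraicClosure L) := IsGalois.mk
  have hone (P : (E⁄L).toAffine.Point) :
      Point.map (W' := E.toAffine) ((1 : L ≃ₐ[K] L) : L →ₐ[K] L) P = P := by
    cases P <;> rfl
  -- Every automorphism over `K` acts on both points by the same sign, and the pairing is unchanged
  -- when both arguments change sign.
  have hmem : ζ ∈ (⊥ : IntermediateField K (AlgebraicClosure L)) := by
    refine (InfiniteGalois.mem_bot_iff_fixed ζ).mpr fun τ => ?_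
    rcases hσ (τ.restrictNormal L) with h | h
    · exact (hτ τ).1 (by rw [h, hone]) (by rw [h, hone])
    · exact (hτ τ).2.1 (by rw [h, hσS]) (by rw [h, hσT])
  obtain ⟨z, rfl⟩ := IntermediateField.mem_bot.mp hmem
  exact ⟨z, hζ.of_map_of_injective (algebraMap K (AlgebraicClosure L)).injective⟩

omit [DecidableEq K] [CharZero K] in
/-- If an automorphism fixes a `p`-torsion point and changes the sign of another one, then the
`p`-th roots of unity are not rational. -/
lemma not_exists_primitiveRoot_of_neg (hp : p.Prime) (hodd : Odd p) {σ : L ≃ₐ[K] L}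
    {S T : (E⁄L).toAffine.Point} (hS : p • S = 0)
    (hT : p • T = 0) (hS0 : S ≠ 0) (hST : T ∉ AddSubgroup.zmultiples S)
    (hσS : Point.map (W' := E.toAffine) (σ : L →ₐ[K] L) S = S)
    (hσT : Point.map (W' := E.toAffine) (σ : L →ₐ[K] L) T = -T) :
    ¬∃ ζ : K, IsPrimitiveRoot ζ p := by
  rintro ⟨z, hz⟩
  obtain ⟨ζ, hζ, hτ⟩ := exists_primitiveRoot_galois hp hodd hS hT hS0 hST
  have : Algebra.IsAlgebraic K (AlgebraicClosure L) := Algebra.IsAlgebraic.trans K L _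
  have : IsAlgClosure K (AlgebraicClosure L) := ⟨inferInstance, inferInstance⟩
  have : Normal K (AlgebraicClosure L) := IsAlgClosure.normal K _
  let τ : AlgebraicClosure L ≃ₐ[K] AlgebraicClosure L := σ.liftNormal (AlgebraicClosure L)
  have hτσ : τ.restrictNormal L = σ := AlgEquiv.restrict_liftNormal (AlgebraicClosure L) σ
  have hneg := (hτ τ).2.2 (by rw [hτσ, hσS]) (by rw [hτσ, hσT])
  have hz' := hz.map_of_injective (algebraMap K (AlgebraicClosure L)).injective
  have : NeZero p := ⟨hp.ne_zero⟩
  -- If `K` contained `z`, the pairing value would be a power of `z`, so fixed by `τ`. But `τ`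
  -- inverts it, so its square is 1 and `p` divides 2.
  obtain ⟨i, -, rfl⟩ := hz'.eq_pow_of_pow_eq_one hζ.pow_eq_one
  rw [map_pow, τ.commutes] at hneg
  have hpow : (algebraMap K (AlgebraicClosure L) z ^ i) ^ 2 = 1 := by
    rw [sq]
    nth_rewrite 1 [hneg]
    exact inv_mul_cancel₀ (hζ.ne_zero hp.ne_zero)
  have h2 := (Nat.dvd_prime Nat.prime_two).mp (hζ.dvd_of_pow_eq_one 2 hpow)
  rcases h2 with rfl | rfl
  · exact hp.one_lt.ne rfl
  · exact absurd hodd (by decide)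

end Quadratic

end WeierstrassCurve

end

/-! ### Independent `p`-torsion points and growth of the primary torsion. -/

section

open WeierstrassCurve WeierstrassCurve.Affine

section Group

variable {A : Type*} [AddCommGroup A] {p : ℕ}

lemma exists_ne_zero_of_addEquiv_zmod (hp : p.Prime)
    (e : AddSubgroup.torsionBy A p ≃+ ZMod p) : ∃ x : A, p • x = 0 ∧ x ≠ 0 := by
  have : Fact p.Prime := ⟨hp⟩
  refine ⟨e.symm 1, mem_torsionBy_natCast.mp (e.symm 1).2, fun h => ?_⟩
  exact one_ne_zero ((e.symm.map_eq_zero_iff).mp (Subtype.ext h))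

lemma mem_zmultiples_of_addEquiv_zmod (hp : p.Prime)
    (e : AddSubgroup.torsionBy A p ≃+ ZMod p) {x y : A} (hx : p • x = 0) (hy : p • y = 0)
    (hx0 : x ≠ 0) : y ∈ AddSubgroup.zmultiples x := by
  have : Fact p.Prime := ⟨hp⟩
  let x' : AddSubgroup.torsionBy A p := ⟨x, mem_torsionBy_natCast.mpr hx⟩
  let y' : AddSubgroup.torsionBy A p := ⟨y, mem_torsionBy_natCast.mpr hy⟩
  have hex : e x' ≠ 0 := fun h => hx0 (congrArg Subtype.val ((e.map_eq_zero_iff).mp h))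
  have key : (e y' / e x').val • x' = y' := by
    refine e.injective ?_
    rw [map_nsmul, nsmul_eq_mul, ZMod.natCast_zmod_val, div_mul_cancel₀ _ hex]
  exact AddSubgroup.mem_zmultiples_iff.mpr ⟨(e y' / e x').val, by
    rw [natCast_zsmul]
    exact congrArg Subtype.val key⟩

lemma exists_independent_of_addEquiv_zmod_prod (hp : p.Prime)
    (e : AddSubgroup.torsionBy A p ≃+ ZMod p × ZMod p) :
    ∃ x y : A, p • x = 0 ∧ p • y = 0 ∧ x ≠ 0 ∧ y ∉ AddSubgroup.zmultiples x := by
  have : Fact p.Prime := ⟨hp⟩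
  refine ⟨e.symm (1, 0), e.symm (0, 1), mem_torsionBy_natCast.mp (e.symm _).2,
    mem_torsionBy_natCast.mp (e.symm _).2, fun h => ?_, ?_⟩
  · have h0 := (e.symm.map_eq_zero_iff).mp (Subtype.ext h)
    exact one_ne_zero (congrArg Prod.fst h0)
  · rintro ⟨a, ha⟩
    have ha' : e.symm (a • (1, 0)) = e.symm (0, 1) := by
      rw [map_zsmul]
      exact Subtype.ext ha
    have h0 := congrArg Prod.snd (e.symm.injective ha')
    rw [Prod.smul_snd, smul_zero] at h0
    exact zero_ne_one h0

end Group

namespace WeierstrassCurve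

variable {K L : Type*} [Field K] [DecidableEq K] [Field L] [DecidableEq L] [Algebra K L]
  {E : WeierstrassCurve K} [E.IsElliptic] {p : ℕ}

omit [DecidableEq K] in
/-- Two independent `p`-torsion points span the `p`-torsion subgroup. -/
lemma exists_eq_nsmul_add_nsmul (hp : p.Prime) (hodd : Odd p) {S T R : (E⁄L).toAffine.Point}
    (hS : p • S = 0) (hT : p • T = 0) (hS0 : S ≠ 0) (hST : T ∉ AddSubgroup.zmultiples S)
    (hR : p • R = 0) :
    R ∈ (Finset.range p ×ˢ Finset.range p).image fun i : ℕ × ℕ => i.1 • S + i.2 • T := by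
  by_contra hmem
  have hcard := card_torsion_le hp hodd (insert R ((Finset.range p ×ˢ Finset.range p).image
    fun i : ℕ × ℕ => i.1 • S + i.2 • T)) fun P hP => by
      rcases Finset.mem_insert.mp hP with rfl | hP
      · exact hR
      · obtain ⟨i, -, rfl⟩ := Finset.mem_image.mp hP
        rw [smul_add, smul_comm, hS, smul_comm p i.2, hT, smul_zero, smul_zero, add_zero]
  rw [Finset.card_insert_of_notMem hmem,
    Finset.card_image_of_injOn (injOn_nsmul_add_nsmul hp hS hT hS0 hST), Finset.card_product,
    Finset.card_range] at hcard
  nlinarith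

omit [DecidableEq K] in
lemma nonempty_torsion_addEquiv_zmod_prod (hp : p.Prime) (hodd : Odd p)
    {S T : (E⁄L).toAffine.Point} (hS : p • S = 0) (hT : p • T = 0) (hS0 : S ≠ 0)
    (hST : T ∉ AddSubgroup.zmultiples S) :
    Nonempty (AddSubgroup.torsionBy (E⁄L).toAffine.Point p ≃+ ZMod p × ZMod p) := by
  refine nonempty_addEquiv_zmod_prod hp
    (fun x => Subtype.ext (mem_torsionBy_natCast.mp x.2)) ?_
  have hiff (R : (E⁄L).toAffine.Point) : R ∈ AddSubgroup.torsionBy (E⁄L).toAffine.Point p ↔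
      R ∈ (Finset.range p ×ˢ Finset.range p).image fun i : ℕ × ℕ => i.1 • S + i.2 • T := by
    rw [mem_torsionBy_natCast]
    refine ⟨exists_eq_nsmul_add_nsmul hp hodd hS hT hS0 hST, fun h => ?_⟩
    obtain ⟨i, -, rfl⟩ := Finset.mem_image.mp h
    rw [smul_add, smul_comm, hS, smul_comm p i.2, hT, smul_zero, smul_zero, add_zero]
  rw [Nat.card_congr (Equiv.subtypeEquivRight hiff), Nat.card_eq_fintype_card, Fintype.card_coe,
    Finset.card_image_of_injOn (injOn_nsmul_add_nsmul hp hS hT hS0 hST), Finset.card_product,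
    Finset.card_range, sq]

section Quadratic

variable {σ : L ≃ₐ[K] L}

omit [E.IsElliptic] in
/-- The `p`-primary torsion does not grow if no `p`-torsion point is mapped to its opposite. -/
lemma primaryComponent_eq_map (hσ : σ * σ = 1)
    (hfix : ∀ x, σ x = x → x ∈ Set.range (algebraMap K L))
    (h : ∀ Q : (E⁄L).toAffine.Point, p • Q = 0 →
      Point.map (W' := E.toAffine) (σ : L →ₐ[K] L) Q = -Q → Q = 0) :
    AddCommGroup.primaryComponent (E⁄L).toAffine.Point p =
      (AddCommGroup.primaryComponent (E⁄K).toAffine.Point p).map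
        (Point.map (W' := E.toAffine) (Algebra.ofId K L)) := by
  have hinj := Point.map_injective (W' := E.toAffine) (Algebra.ofId K L)
  ext R
  constructor
  · intro hR
    obtain ⟨n, hn⟩ := AddCommGroup.mem_primaryComponent.mp hR
    obtain ⟨Q, rfl⟩ := exists_map_eq_of_fixed hfix (apply_eq_self_of_pow_nsmul_eq_zero
      (Point.map (W' := E.toAffine) (σ : L →ₐ[K] L)) (map_map_of_mul_self_eq_one hσ) h hn)
    refine ⟨Q, AddCommGroup.mem_primaryComponent.mpr ⟨n, hinj ?_⟩, rfl⟩
    rw [map_nsmul, hn, map_zero]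
  · rintro ⟨Q, hQ, rfl⟩
    obtain ⟨n, hn⟩ := AddCommGroup.mem_primaryComponent.mp hQ
    exact AddCommGroup.mem_primaryComponent.mpr ⟨n, by rw [← map_nsmul, hn, map_zero]⟩

omit [DecidableEq K] [E.IsElliptic] in
/-- A fixed point and a nonzero point mapped to its opposite are independent. -/
lemma notMem_zmultiples_of_map_eq_neg (hodd : Odd p) {P Q : (E⁄L).toAffine.Point}
    (hP : Point.map (W' := E.toAffine) (σ : L →ₐ[K] L) P = P)
    (hQ : Point.map (W' := E.toAffine) (σ : L →ₐ[K] L) Q = -Q) (hpQ : p • Q = 0) (hQ0 : Q ≠ 0) :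
    Q ∉ AddSubgroup.zmultiples P := by
  intro hmem
  obtain ⟨a, rfl⟩ := AddSubgroup.mem_zmultiples_iff.mp hmem
  rw [map_zsmul, hP] at hQ
  exact hQ0 (eq_zero_of_neg_eq_self hodd hpQ hQ.symm)

end Quadratic

end WeierstrassCurve

end

/-! ### The six statements. -/

theorem mainTheorem4 {K L : Type*} [Field K] [NumberField K] [DecidableEq K]
    [Field L] [DecidableEq L] [Algebra K L] [Algebra.IsQuadraticExtension K L]
    (E : WeierstrassCurve K) [E.IsElliptic] (p : ℕ) (hp : p.Prime) (hp_odd : Odd p) :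
    (Nonempty (AddSubgroup.torsionBy (E⁄K).toAffine.Point 2 ≃+ ZMod 1) →
      Nonempty (AddSubgroup.torsionBy (E⁄L).toAffine.Point 2 ≃+ ZMod 1)) ∧
    (∀ d : K, d ≠ 0 →
      Nonempty (AddSubgroup.torsionBy ((E.quadraticTwist d)⁄K).toAffine.Point 2 ≃+
        AddSubgroup.torsionBy (E⁄K).toAffine.Point 2)) ∧
    (Nonempty (AddSubgroup.torsionBy (E⁄K).toAffine.Point p ≃+ ZMod 1) →
      Nonempty (AddSubgroup.torsionBy (E⁄L).toAffine.Point p ≃+ ZMod p × ZMod p) →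
      ∃ ζ : K, IsPrimitiveRoot ζ p) ∧
    (Nonempty (AddSubgroup.torsionBy (E⁄K).toAffine.Point p ≃+ ZMod p) →
      AddCommGroup.primaryComponent (E⁄L).toAffine.Point p ≠
        (AddCommGroup.primaryComponent (E⁄K).toAffine.Point p).map
          (WeierstrassCurve.Affine.Point.map (W' := E.toAffine) (Algebra.ofId K L)) →
      Nonempty (AddSubgroup.torsionBy (E⁄L).toAffine.Point p ≃+ ZMod p × ZMod p)) ∧
    (Nonempty (AddSubgroup.torsionBy (E⁄K).toAffine.Point p ≃+ ZMod p) →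
      Nonempty (AddSubgroup.torsionBy (E⁄L).toAffine.Point p ≃+ ZMod p × ZMod p) →
      ¬ ∃ ζ : K, IsPrimitiveRoot ζ p) ∧
    (Nonempty (AddSubgroup.torsionBy (E⁄K).toAffine.Point p ≃+ ZMod p × ZMod p) →
      AddCommGroup.primaryComponent (E⁄L).toAffine.Point p =
        (AddCommGroup.primaryComponent (E⁄K).toAffine.Point p).map
          (WeierstrassCurve.Affine.Point.map (W' := E.toAffine) (Algebra.ofId K L))) := by
  open WeierstrassCurve WeierstrassCurve.Affine in
  obtain ⟨σ, hσall, hσσ, hσfix⟩ := exists_galois_involution K L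
  let s : (E⁄L).toAffine.Point →+ (E⁄L).toAffine.Point :=
    Point.map (W' := E.toAffine) (σ : L →ₐ[K] L)
  let ι : (E⁄K).toAffine.Point →+ (E⁄L).toAffine.Point :=
    Point.map (W' := E.toAffine) (Algebra.ofId K L)
  have hι : Function.Injective ι := Point.map_injective ..
  have hss : ∀ P, s (s P) = P := map_map_of_mul_self_eq_one hσσ
  have hsι : ∀ P, s (ι P) = ι P := map_map_ofId σ
  have hdesc : ∀ P, s P = P → ∃ Q, ι Q = P := fun P => exists_map_eq_of_fixed hσfix
  have htors {n : ℕ} {Q : (E⁄K).toAffine.Point} (h : n • ι Q = 0) : n • Q = 0 :=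
    hι (by rw [map_nsmul, h, map_zero])
  have hι0 {Q : (E⁄K).toAffine.Point} (h : Q ≠ 0) : ι Q ≠ 0 :=
    fun h0 => h (hι (h0.trans (map_zero ι).symm))
  -- The trace `P + s P` is a rational `n`-torsion point, hence zero.
  have htrivial {n : ℕ} (h : ∀ Q : (E⁄K).toAffine.Point, n • Q = 0 → Q = 0)
      (P : (E⁄L).toAffine.Point) (hP : n • P = 0) : s P = -P := by
    obtain ⟨Q, hQ⟩ := hdesc (P + s P) (by rw [map_add, hss, add_comm])
    have hnQ : n • ι Q = 0 := by rw [hQ, smul_add, ← map_nsmul, hP, map_zero, add_zero]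
    rw [h Q (htors hnQ), map_zero] at hQ
    exact eq_neg_of_add_eq_zero_right hQ.symm
  refine ⟨fun h => ?_, fun d hd => ?_, fun h h' => ?_, ?_, ?_, ?_⟩
  · replace h := (nonempty_addEquiv_zmod_one_iff 2).mp h
    refine (nonempty_addEquiv_zmod_one_iff 2).mpr fun P hP => ?_
    obtain ⟨Q, rfl⟩ := hdesc P (by
      rw [htrivial h P hP, neg_eq_iff_add_eq_zero, ← two_nsmul, hP])
    rw [h Q (htors hP), map_zero]
  · have : (E.quadraticTwist d).IsElliptic := quadraticTwist_isElliptic E hd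
    have h4 : (4 : K) ≠ 0 := by norm_num
    refine nonempty_twoTorsion_addEquiv (W := (E⁄K).toAffine)
      (W' := ((E.quadraticTwist d)⁄K).toAffine) hd ?_ ?_ ?_ <;>
    · simp only [WeierstrassCurve.baseChange, map_b₂, map_b₄, map_b₆, Algebra.algebraMap_self, RingHom.id_apply]
      simp only [quadraticTwist, b₂, b₄, b₆]
      field_simp
      ring
  · replace h := (nonempty_addEquiv_zmod_one_iff p).mp h
    obtain ⟨e⟩ := h'
    obtain ⟨S, T, hS, hT, hS0, hST⟩ := exists_independent_of_addEquiv_zmod_prod hp e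
    exact exists_primitiveRoot_of_neg hp hp_odd hσall hS hT hS0 hST (htrivial h S hS)
      (htrivial h T hT)
  · rintro ⟨e⟩ hne
    obtain ⟨P, hP, hP0⟩ := exists_ne_zero_of_addEquiv_zmod hp e
    by_contra hcon
    refine hne (primaryComponent_eq_map hσσ hσfix fun Q hQ hsQ => ?_)
    by_contra hQ0
    exact hcon (nonempty_torsion_addEquiv_zmod_prod hp hp_odd
      (by rw [← map_nsmul, hP, map_zero]) hQ (hι0 hP0)
      (notMem_zmultiples_of_map_eq_neg hp_odd (hsι P) hsQ hQ hQ0))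
  · rintro ⟨e⟩ ⟨e'⟩
    obtain ⟨P, hP, hP0⟩ := exists_ne_zero_of_addEquiv_zmod hp e
    obtain ⟨S, T, hS, hT, hS0, hST⟩ := exists_independent_of_addEquiv_zmod_prod hp e'
    -- If `s` fixed all `p`-torsion, the independent `S` and `T` would descend to the cyclic group
    -- `E(K)[p]`. For a moved `R`, the difference `R - s R` is a nonzero point negated by `s`.
    obtain ⟨R, hR, hsR⟩ : ∃ R, p • R = 0 ∧ s R ≠ R := by
      by_contra! hcon
      obtain ⟨S, rfl⟩ := hdesc S (hcon S hS)
      obtain ⟨T, rfl⟩ := hdesc T (hcon T hT)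
      obtain ⟨a, rfl⟩ := AddSubgroup.mem_zmultiples_iff.mp (mem_zmultiples_of_addEquiv_zmod hp e
        (htors hS) (htors hT) fun h0 => hS0 (by rw [h0, map_zero]))
      exact hST (AddSubgroup.mem_zmultiples_iff.mpr ⟨a, (map_zsmul ι a S).symm⟩)
    have hQ : p • (R - s R) = 0 := by rw [smul_sub, ← map_nsmul, hR, map_zero, sub_zero]
    have hsQ : s (R - s R) = -(R - s R) := by rw [map_sub, hss, neg_sub]
    have hQ0 : R - s R ≠ 0 := fun h0 => hsR (sub_eq_zero.mp h0).symm
    exact not_exists_primitiveRoot_of_neg hp hp_odd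
      (S := ι P) (by rw [← map_nsmul, hP, map_zero]) hQ (hι0 hP0)
      (notMem_zmultiples_of_map_eq_neg hp_odd (hsι P) hsQ hQ hQ0) (hsι P) hsQ
  · rintro ⟨e⟩
    obtain ⟨S, T, hS, hT, hS0, hST⟩ := exists_independent_of_addEquiv_zmod_prod hp e
    refine primaryComponent_eq_map hσσ hσfix fun Q hQ hsQ => ?_
    have hST' : ι T ∉ AddSubgroup.zmultiples (ι S) := by
      intro h
      obtain ⟨a, ha⟩ := AddSubgroup.mem_zmultiples_iff.mp h
      exact hST (AddSubgroup.mem_zmultiples_iff.mpr ⟨a, hι (by rw [map_zsmul, ha])⟩)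
    -- Two independent rational points already span `E(L)[p]`, so `Q` is fixed as well as negated,
    -- and vanishes as `p` is odd.
    obtain ⟨i, -, rfl⟩ := Finset.mem_image.mp (exists_eq_nsmul_add_nsmul hp hp_odd
      (S := ι S) (T := ι T) (by rw [← map_nsmul, hS, map_zero])
      (by rw [← map_nsmul, hT, map_zero]) (hι0 hS0) hST' hQ)
    refine eq_zero_of_neg_eq_self hp_odd hQ (hsQ.symm.trans ?_)
    change s _ = _
    rw [map_add, map_nsmul, map_nsmul, hsι, hsι]
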